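/- **Multiple sine functions.** For $\underline\omega=(\omega_1,\dots,\omega_m)$ with $\mathrm{Re}\,\omega_i>0$ let $\zeta_m(s,x|\underline\omega)$ be the analytic continuation in $s$ (to $\mathbb C\setminus\{1,\dots,m\}$) of $\sum_{k_1,\dots,k_m\ge 0}(k_1\omega_1+\cdots+k_m\omega_m+x)^{-s}$, $\mathrm{Re}\,s>m$. Put $\Gamma_m(x|\underline\omega)=\exp\big(\partial_s\zeta_m(s,x|\underline\omega)|_{s=0}\big)$ and $S_m(x|\underline\omega)=\Gamma_m(x|\underline\omega)^{-1}\,\Gamma_m(|\underline\omega|-x|\underline\omega)^{(-1)^m}$, where $|\underline\omega|=\omega_1+\cdots+\omega_m$. **The functions $G_n$.** For $0<\nu<1$, $\lambda>0$ write $S_2(x)=S_2(x|\lambda,\frac{\pi}{\nu})$, $S_3(x)=S_3(x|2\pi,\lambda,\frac\pi\nu)$ and $$\rho(\beta)=\sinh\tfrac{\pi\beta}{\lambda}\,\frac{S_3(\pi-i\beta)S_3(\pi+\lambda+i\beta)}{S_3(-i\beta)S_3(\lambda+i\beta)},\qquad \varphi(\beta)=\frac{2}{S_2(\frac\pi2+i\beta)S_2(\frac\pi2-i\beta)},$$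 $$\psi(\beta)=\sinh\tfrac{\pi\beta}{\lambda}\,S_2(\pi+i\beta)S_2(\pi-i\beta),\qquad c_n=(-16)^{n(n-1)/2}\Big(\frac{\pi S_2(\pi)^2}{\lambda\rho(\pi i)}\Big)^n .$$ For signs $\epsilon_1,\dots,\epsilon_{2n}\in\{+,-\}$ of which exactly $n$ are $+$, let $\bar1<\cdots<\bar n$ be the positions of the signs $+$, and let $$G_n(b_1,\dots,b_{2n})_{\epsilon_1\cdots\epsilon_{2n}}=c_n\prod_{j<k}\rho(b_j-b_k)\prod_{a=1}^n\int_{C_a}\frac{d\alpha_a}{2\pi i}\ \prod_{a,j}\varphi(\alpha_a-b_j)\prod_{a<a'}\psi(\alpha_a-\alpha_{a'})\ Q_n ,$$ $$Q_n=\frac{\prod_{a}\Big[\prod_{j<\bar a}\sinh\nu(\alpha_a-b_j+\frac{\pi i}2)\prod_{j>\bar a}\sinh\nu(b_j-\alpha_a+\frac{\pi i}2)\Big]}{\prod_{a<a'}\sinh\nu(\alpha_a-\alpha_{a'}-\pi i)} .$$ **The correlator.** Let $\lambda=2\pi$, let $r\le s$ be integers, $n=s-r+1$, let $\beta_r,\dots,\beta_s$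 be real and let $\varepsilon'_j,\varepsilon_j\in\{+,-\}$ ($r\le j\le s$) satisfy $\#\{j:\varepsilon'_j=-\}+\#\{j:\varepsilon_j=+\}=n$. Define $$\langle E^{(r)}_{\varepsilon'_r\varepsilon_r}\cdots E^{(s)}_{\varepsilon'_s\varepsilon_s}\rangle(\beta_r,\dots,\beta_s)=G_n(\beta_r+\pi i,\dots,\beta_s+\pi i,\beta_s,\dots,\beta_r)_{-\varepsilon'_r,\dots,-\varepsilon'_s,\varepsilon_s,\dots,\varepsilon_r},$$ where $C_a$ is a horizontal line, directed from $-\infty$ to $+\infty$, with $\frac\pi2<\mathrm{Im}\,\alpha_a<\pi$ if $\bar a\le n$ and $0<\mathrm{Im}\,\alpha_a<\frac\pi2$ if $\bar a\ge n+1$ (it passes just above, respectively just below, the points $\beta_j+\frac{\pi i}2$). When some of the $\beta_j$ coincide, so that removable singularities of $\rho$ are met, the correlator is the limit of its values at pairwise distinct real parameters. Number the $2n$ positions $r,\dots,s+n$ instead of $1,\dots,2n$, so that $$\{\bar1<\cdots<\bar n\}=\{j\mid r\le j\le s,\ \varepsilon'_j=-\}\cup\{j^*\mid r\le j\le s,\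 \varepsilon_j=+\},\qquad j^*=2s+1-j .$$ **Statement.** If $\nu=\frac12$, the integrals converge absolutely and $$\langle E^{(r)}_{\varepsilon'_r\varepsilon_r}\cdots E^{(s)}_{\varepsilon'_s\varepsilon_s}\rangle(\beta_r,\dots,\beta_s)=\prod_{r\le j<k\le s}2i\cosh\tfrac12(\beta_j-\beta_k)\times\det\big(I_{k\bar{k'}}\big)_{1\le k,k'\le n},$$ where for $1\le k\le n$ and $r\le l\le s$ $$I_{kl}=2\,i^{\,2r-s+1-l}\int\frac{d\alpha}{2\pi}\,e^{(k-\frac{n+1}2)\alpha}\prod_{j=r}^{l}\frac1{2\cosh\frac12(\alpha-\beta_j)}\prod_{j=l}^{s}\frac1{2\sinh\frac12(\alpha-\beta_j)},$$ the integral being along any line $\mathrm{Im}\,\alpha=\eta$ with $0<\eta<\pi$ directed from $-\infty$ to $+\infty$, and $I_{kl}=\overline{I_{kl^*}}$ for $s+1\le l\le s+n$. -/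

import Mathlib

namespace XXZ

open scoped BigOperators ComplexConjugate

/-! ### Multiple gamma and sine functions (Barnes, Shintani, Kurokawa) -/

/-- `k · ω + x = k₁ ω₁ + ⋯ + k_r ω_r + x`. -/
noncomputable def latticePoint {r : ℕ} (ω : Fin r → ℂ) (x : ℂ) (k : Fin r → ℕ) : ℂ :=
  (∑ i, (k i : ℂ) * ω i) + x

/-- `Z` is the analytic continuation, holomorphic away from `s = 1, …, r`, of the multiple Hurwitz
series `∑_{k₁,…,k_r ≥ 0} (k · ω + x)^{-s}`, `Re s > r`. Such a `Z` is unique away from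
`s = 1, …, r`. -/
def IsMultipleHurwitzZeta {r : ℕ} (ω : Fin r → ℂ) (x : ℂ) (Z : ℂ → ℂ) : Prop :=
  DifferentiableOn ℂ Z {s : ℂ | ∀ m : ℕ, 1 ≤ m → m ≤ r → s ≠ (m : ℂ)} ∧
    ∀ s : ℂ, (r : ℝ) < s.re → Z s = ∑' k : Fin r → ℕ, latticePoint ω x k ^ (-s)

/-- The multiple Hurwitz zeta function `ζ_r(s, x | ω)`, as a function of `s`. -/
noncomputable def multipleHurwitzZeta {r : ℕ} (ω : Fin r → ℂ) (x : ℂ) : ℂ → ℂ :=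
  Classical.epsilon (IsMultipleHurwitzZeta ω x)

open Classical in
/-- The multiple gamma function `Γ_r(x | ω) = exp (∂_s ζ_r(s, x | ω) at s = 0)`. At its poles, the
points `x = -(k · ω)`, it is given the value `0`, so that `Γ_r⁻¹` has its true value there. -/
noncomputable def multipleGamma {r : ℕ} (ω : Fin r → ℂ) (x : ℂ) : ℂ :=
  if ∃ k : Fin r → ℕ, latticePoint ω x k = 0 then 0
  else Complex.exp (deriv (multipleHurwitzZeta ω x) 0)

/-- The multiple sine function `S_r(x | ω) = Γ_r(x | ω)⁻¹ Γ_r(|ω| - x | ω)^{(-1)^r}`,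
`|ω| = ω₁ + ⋯ + ω_r`. -/
noncomputable def multipleSine {r : ℕ} (ω : Fin r → ℂ) (x : ℂ) : ℂ :=
  (multipleGamma ω x)⁻¹ * multipleGamma ω ((∑ i, ω i) - x) ^ ((-1 : ℤ) ^ r)

/-! ### The auxiliary functions -/

/-- `S₂(x | λ, π/ν)`. -/
noncomputable def S2 (ν lam : ℝ) (x : ℂ) : ℂ :=
  multipleSine ![(lam : ℂ), ((Real.pi / ν : ℝ) : ℂ)] x

/-- `S₃(x | 2π, λ, π/ν)`. -/
noncomputable def S3 (ν lam : ℝ) (x : ℂ) : ℂ :=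
  multipleSine ![((2 * Real.pi : ℝ) : ℂ), (lam : ℂ), ((Real.pi / ν : ℝ) : ℂ)] x

/-- The function `ρ(β)`. -/
noncomputable def rho (ν lam : ℝ) (b : ℂ) : ℂ :=
  Complex.sinh (Real.pi * b / lam) *
    (S3 ν lam (Real.pi - Complex.I * b) * S3 ν lam (Real.pi + lam + Complex.I * b)) /
    (S3 ν lam (-(Complex.I * b)) * S3 ν lam (lam + Complex.I * b))

/-- The function `φ(β)`. -/
noncomputable def phi (ν lam : ℝ) (b : ℂ) : ℂ :=
  2 / (S2 ν lam (Real.pi / 2 + Complex.I * b) * S2 ν lam (Real.pi / 2 - Complex.I * b))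

/-- The function `ψ(β)`. -/
noncomputable def psi (ν lam : ℝ) (b : ℂ) : ℂ :=
  Complex.sinh (Real.pi * b / lam) *
    S2 ν lam (Real.pi + Complex.I * b) * S2 ν lam (Real.pi - Complex.I * b)

/-- The constant `c_n`. -/
noncomputable def cConst (ν lam : ℝ) (n : ℕ) : ℂ :=
  (-16 : ℂ) ^ (n * (n - 1) / 2) *
    (Real.pi * S2 ν lam Real.pi ^ 2 / (lam * rho ν lam (Real.pi * Complex.I))) ^ n

/-! ### The integral formula for `G_n`

A sign is a `Bool`, `true` standing for `+` and `false` for `-`. -/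

/-- The positions of the signs `+` in a sequence of `2n` signs. -/
def plusSet {n : ℕ} (ε : Fin (n + n) → Bool) : Finset (Fin (n + n)) :=
  Finset.univ.filter (fun p => ε p = true)

/-- The increasing map `a ↦ ā` enumerating the positions of the `n` signs `+`. -/
def bar {n : ℕ} (ε : Fin (n + n) → Bool) (hε : (plusSet ε).card = n) : Fin n → Fin (n + n) :=
  fun a => (plusSet ε).orderEmbOfFin hε a

/-- The function `Q_n(α | β)_ε`. -/
noncomputable def Q (ν : ℝ) {n : ℕ} (ε : Fin (n + n) → Bool) (hε : (plusSet ε).card = n)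
    (b : Fin (n + n) → ℂ) (α : Fin n → ℂ) : ℂ :=
  (∏ a : Fin n,
      (∏ j ∈ Finset.Iio (bar ε hε a),
          Complex.sinh (ν * (α a - b j + Real.pi * Complex.I / 2))) *
        ∏ j ∈ Finset.Ioi (bar ε hε a),
          Complex.sinh (ν * (b j - α a + Real.pi * Complex.I / 2))) /
    ∏ a : Fin n, ∏ a' ∈ Finset.Ioi a, Complex.sinh (ν * (α a - α a' - Real.pi * Complex.I))

/-- The point `(α_1, …, α_n)` whose component `α_a` lies on the horizontal line `Im α_a = h_a`. -/
noncomputable def onLines {n : ℕ} (h : Fin n → ℝ) (t : Fin n → ℝ) : Fin n → ℂ :=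
  fun a => (t a : ℂ) + (h a : ℂ) * Complex.I

/-- The integrand of the `n`-fold integral for `G_n`, including the factors `1 / (2πi)`. -/
noncomputable def integrandG (ν lam : ℝ) {n : ℕ} (ε : Fin (n + n) → Bool)
    (hε : (plusSet ε).card = n) (b : Fin (n + n) → ℂ) (α : Fin n → ℂ) : ℂ :=
  (∏ _a : Fin n, 1 / (2 * Real.pi * Complex.I)) *
    (∏ a : Fin n, ∏ j : Fin (n + n), phi ν lam (α a - b j)) *
    (∏ a : Fin n, ∏ a' ∈ Finset.Ioi a, psi ν lam (α a - α a')) *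
    Q ν ε hε b α

/-- The integral formula for `G_n(β_1, …, β_{2n})_ε`, the contour `C_a` being the line
`Im α_a = h_a`, directed from `-∞` to `+∞`. -/
noncomputable def G (ν lam : ℝ) {n : ℕ} (ε : Fin (n + n) → Bool) (hε : (plusSet ε).card = n)
    (h : Fin n → ℝ) (b : Fin (n + n) → ℂ) : ℂ :=
  cConst ν lam n * (∏ j : Fin (n + n), ∏ k ∈ Finset.Ioi j, rho ν lam (b j - b k)) *
    ∫ t : Fin n → ℝ, integrandG ν lam ε hε b (onLines h t)

/-! ### The inhomogeneous correlator

The sites `r, …, s = r + n - 1` are indexed by `Fin n`. -/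

/-- The sign sequence `(-ε'_r, …, -ε'_s, ε_s, …, ε_r)`. -/
def corrSigns {n : ℕ} (ε' ε : Fin n → Bool) : Fin (n + n) → Bool :=
  Fin.append (fun j => !ε' j) (fun j => ε j.rev)

/-- The parameters `(β_r + πi, …, β_s + πi, β_s, …, β_r)`. -/
noncomputable def corrParams {n : ℕ} (β : Fin n → ℝ) : Fin (n + n) → ℂ :=
  Fin.append (fun j => (β j : ℂ) + Real.pi * Complex.I) (fun j => (β j.rev : ℂ))

/-- Contours for the specialised integrand. The line `Im α_a = π/2` carries the points
`β_j + πi/2`; the contour `C_a` runs just above them if `ā` is one of the first `n` positions and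
just below them if `ā` is one of the last `n` positions. -/
def IsCorrContour {n : ℕ} (ε : Fin (n + n) → Bool) (hε : (plusSet ε).card = n)
    (h : Fin n → ℝ) : Prop :=
  ∀ a : Fin n,
    ((bar ε hε a : ℕ) < n → Real.pi / 2 < h a ∧ h a < Real.pi) ∧
    (n ≤ (bar ε hε a : ℕ) → 0 < h a ∧ h a < Real.pi / 2)

/-- The inhomogeneous correlator
`⟨E^{(r)}_{ε'_r ε_r} ⋯ E^{(s)}_{ε'_s ε_s}⟩(β_r, …, β_s)`, i.e.
`G_n(β_r + πi, …, β_s + πi, β_s, …, β_r)_{-ε'_r, …, -ε'_s, ε_s, …, ε_r}` at `λ = 2π`. -/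
noncomputable def correlator (ν : ℝ) {n : ℕ} (ε' ε : Fin n → Bool)
    (hε : (plusSet (corrSigns ε' ε)).card = n) (h : Fin n → ℝ) (β : Fin n → ℝ) : ℂ :=
  G ν (2 * Real.pi) (corrSigns ε' ε) hε h (corrParams β)

/-! ### The determinant -/

/-- The integrand of `I_{kl}` without the constant `2 i^{2r-s+1-l}`. The index `k : Fin n` stands
for the number `k + 1`, and `l : Fin n` for the site `r + l`. -/
noncomputable def integrandI {n : ℕ} (β : Fin n → ℝ) (k l : Fin n) (α : ℂ) : ℂ :=
  1 / (2 * Real.pi) * Complex.exp ((((k : ℕ) : ℂ) + 1 - ((n : ℂ) + 1) / 2) * α) *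
    (∏ j ∈ Finset.Iic l, 1 / (2 * Complex.cosh ((α - β j) / 2))) *
    ∏ j ∈ Finset.Ici l, 1 / (2 * Complex.sinh ((α - β j) / 2))

/-- `I_{kl}` for a site `l`, the integration being along the line `Im α = η`. With the sites
labelled by `r = 1, …, s = n`, the exponent is `2r - s + 1 - l`. -/
noncomputable def entryI {n : ℕ} (β : Fin n → ℝ) (η : ℝ) (k l : Fin n) : ℂ :=
  2 * Complex.I ^ ((2 : ℤ) * 1 - (n : ℤ) + 1 - ((l : ℕ) + 1 : ℤ)) *
    ∫ t : ℝ, integrandI β k l ((t : ℂ) + (η : ℂ) * Complex.I)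

/-- `I_{kp}` for a position `p` among all `2n` positions: for the last `n` positions it is the
complex conjugate of `I_{kp*}`, where `p ↦ p*` reflects these positions to the sites. -/
noncomputable def entryIExt {n : ℕ} (β : Fin n → ℝ) (η : ℝ) (k : Fin n) (p : Fin (n + n)) : ℂ :=
  Fin.append (fun l : Fin n => entryI β η k l)
    (fun q : Fin n => conj (entryI β η k q.rev)) p

/-- `∏_{j<k} 2i cosh((β_j - β_k)/2) × det (I_{k k̄'})`. -/
noncomputable def determinantFormula {n : ℕ} (ε : Fin (n + n) → Bool)
    (hε : (plusSet ε).card = n) (η : ℝ) (β : Fin n → ℝ) : ℂ :=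
  (∏ j : Fin n, ∏ k ∈ Finset.Ioi j,
      2 * Complex.I * Complex.cosh (((β j : ℂ) - β k) / 2)) *
    Matrix.det (Matrix.of fun k k' : Fin n => entryIExt β η k (bar ε hε k'))

end XXZ

/-! At `ν = 1/2`, `λ = 2π` all periods of the multiple sine functions equal `2π`, and every
combination of them that enters the correlator becomes elementary. For equal periods the multiple
Hurwitz zeta function is a combination of `ζ(s - j, y)`, so the shift `y ↦ y + 1` and Euler's sine
product (`exp_deriv_complexHurwitz_reflection`) give `S3_add_two_pi` and `S2_add_two_pi`. Hence
`S₂(π + a) S₂(π - a) = 2 cos (a/2)` and `S₂(a) S₂(-a) = -4 sin² (a/2)`.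

It follows that `ψ` is `sinh`. The functions `φ` and `ρ` are not needed separately: the parameters
come in pairs `β_j + πi`, `β_j`, so `φ` occurs in products of two values (`phi_mul_phi`) and `ρ` in
products of four (`rho_prod`). The normalisation `c_n` cancels the values `ρ(πi)`, leaving one
factor `-2 cosh ((β_j - β_k)/2)` for each pair of sites (`prefactor_eq`).

In the integrand, the denominator of `Q_n` cancels half of each `sinh (α_a - α_a')`. What remains is
a product of `2 sinh` of half differences, which is the Vandermonde determinant of the exponentials
`e^{(k - (n+1)/2) α_a}` (`det_exp_eq`). All other factors depend on a single `α_a`, so they can be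
absorbed into the columns, and the integrand is a determinant whose column `a` depends on `α_a`
alone (`integrandG_eq_det`). Such a determinant is integrated entry by entry (`integral_det`).

After the substitution `α = w + πi/2` the contours lie in the strips `0 < Im w < π/2` and `-π/2 < Im
w < 0`. Cauchy's theorem moves the upper lines to height `η`; the lower ones are complex conjugates
of upper ones, whence the conjugate entries of the matrix. Coinciding parameters are reached because
the determinant formula is continuous in `β`. -/

namespace XXZ

open Complex Filter Topology Set MeasureTheory
open scoped ComplexConjugate

/-! ### The Hurwitz zeta function with a complex shift -/

/-- The binomial coefficient `binom (-s) j`. -/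
noncomputable def negBinom : ℕ → ℂ → ℂ
  | 0, _ => 1
  | j + 1, s => -s * negBinom j (s + 1) / (j + 1)

/-- The defining recursion shifts `s`, as differentiating `(1 + u)^(-s)` does. This one keeps `s`
fixed and exposes the factor `s + j`, which later cancels the pole of `ζ(s + j + 1)`. -/
theorem negBinom_succ (j : ℕ) (s : ℂ) :
    negBinom (j + 1) s = negBinom j s * (-(s + j) / (j + 1)) := by
  induction j generalizing s with
  | zero => simp [negBinom]
  | succ j ih =>
    change -s * negBinom (j + 1) (s + 1) / ((j + 1 : ℕ) + 1) =
      -s * negBinom j (s + 1) / (j + 1) * (-(s + (j + 1 : ℕ)) / ((j + 1 : ℕ) + 1))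
    rw [ih (s + 1)]
    push_cast
    ring

theorem differentiable_negBinom (j : ℕ) : Differentiable ℂ (negBinom j) := by
  induction j with
  | zero => exact differentiable_const 1
  | succ j ih =>
    have : negBinom (j + 1) = fun s => negBinom j s * (-(s + j) / (j + 1)) :=
      funext (negBinom_succ j)
    rw [this]
    fun_prop

/-- The remainder of the binomial series of `(1 + u) ^ (-s)`. -/
noncomputable def binomRem (J : ℕ) (s u : ℂ) : ℂ :=
  (1 + u) ^ (-s) - ∑ j ∈ Finset.range J, negBinom j s * u ^ j

theorem one_add_mem_slitPlane_of_norm_le_half {u : ℂ} (hu : ‖u‖ ≤ 1 / 2) :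
    1 + u ∈ slitPlane := by
  left
  have := (abs_le.1 (Complex.abs_re_le_norm u)).1
  simp only [add_re, one_re]
  linarith

theorem hasDerivAt_binomRem (J : ℕ) (s : ℂ) {u : ℂ} (hu : ‖u‖ ≤ 1 / 2) :
    HasDerivAt (binomRem (J + 1) s) (-s * binomRem J (s + 1) u) u := by
  have h1 : HasDerivAt (fun v : ℂ => (1 + v) ^ (-s)) (-s * (1 + u) ^ (-s - 1) * 1) u :=
    ((hasDerivAt_id u).const_add 1).cpow_const (one_add_mem_slitPlane_of_norm_le_half hu)
  have h2 : HasDerivAt (fun v : ℂ => ∑ j ∈ Finset.range (J + 1), negBinom j s * v ^ j)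
      (∑ j ∈ Finset.range (J + 1), negBinom j s * (j * u ^ (j - 1))) u :=
    HasDerivAt.fun_sum fun j _ => (hasDerivAt_pow j u).const_mul _
  refine (h1.sub h2).congr_deriv ?_
  rw [Finset.sum_range_succ']
  simp only [binomRem, negBinom, mul_sub, Finset.mul_sum]
  rw [show -s - 1 = -(s + 1) by ring]
  simp only [Nat.cast_zero, zero_mul, mul_zero, add_zero, mul_one]
  congr 1
  refine Finset.sum_congr rfl fun j _ => ?_
  have : (j + 1 : ℂ) ≠ 0 := Nat.cast_add_one_ne_zero j
  push_cast
  field_simp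

/-- Taylor's estimate by induction on `J`: the derivative of the remainder is `-s` times the
previous remainder at `s + 1`, so the mean value inequality gains one power of `u`. The shift of `s`
is why `A` is generalised, the induction hypothesis being used with `A + 1`. -/
theorem exists_norm_binomRem_le (J : ℕ) (A : ℝ) :
    ∃ C : ℝ, 0 ≤ C ∧ ∀ s : ℂ, ‖s‖ ≤ A → ∀ u : ℂ, ‖u‖ ≤ 1 / 2 → ‖binomRem J s u‖ ≤ C * ‖u‖ ^ J := by
  induction J generalizing A with
  | zero =>
    refine ⟨Real.exp A, (Real.exp_pos _).le, fun s hs u hu => ?_⟩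
    have h0 : 1 + u ≠ 0 := slitPlane_ne_zero (one_add_mem_slitPlane_of_norm_le_half hu)
    simp only [binomRem, Finset.range_zero, Finset.sum_empty, sub_zero, pow_zero, mul_one]
    rw [cpow_def_of_ne_zero h0]
    refine (norm_exp_le_exp_norm _).trans (Real.exp_le_exp.2 ?_)
    rw [norm_mul, norm_neg]
    have := norm_log_one_add_half_le_self hu
    nlinarith [norm_nonneg s, norm_nonneg (log (1 + u))]
  | succ J ih =>
    obtain ⟨C, hC, h⟩ := ih (A + 1)
    refine ⟨|A| * C, by positivity, fun s hs u hu => ?_⟩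
    have hs1 : ‖s + 1‖ ≤ A + 1 := (norm_add_le _ _).trans (by simpa using hs)
    have key := Convex.norm_image_sub_le_of_norm_hasDerivWithin_le (𝕜 := ℂ)
      (f := binomRem (J + 1) s) (f' := fun v => -s * binomRem J (s + 1) v)
      (s := Metric.closedBall 0 ‖u‖) (C := |A| * (C * ‖u‖ ^ J)) (x := 0) (y := u)
      (fun v hv => (hasDerivAt_binomRem J s
        ((mem_closedBall_zero_iff.1 hv).trans hu)).hasDerivWithinAt)
      (fun v hv => by
        have hv' := mem_closedBall_zero_iff.1 hv
        rw [norm_mul, norm_neg]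
        gcongr
        · exact hs.trans (le_abs_self A)
        · exact (h (s + 1) hs1 v (hv'.trans hu)).trans (by gcongr))
      (convex_closedBall 0 _) (by simp) (by simp)
    have h0 : binomRem (J + 1) s 0 = 0 := by
      simp [binomRem, Finset.sum_range_succ', negBinom]
    rw [h0, sub_zero, sub_zero] at key
    calc _ ≤ _ := key
      _ = _ := by ring

theorem one_add_div_cpow (y s : ℂ) (k : ℕ) (h : (k : ℂ) + 1 + y ≠ 0) :
    ((k : ℂ) + 1 + y) ^ (-s) = ((k : ℂ) + 1) ^ (-s) * (1 + y / (k + 1)) ^ (-s) := by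
  have hk : (k + 1 : ℂ) ≠ 0 := Nat.cast_add_one_ne_zero k
  have hk' : (0 : ℝ) < k + 1 := by positivity
  have e : (k : ℂ) + 1 + y = ((k + 1 : ℝ) : ℂ) * (1 + y / (k + 1)) := by
    push_cast
    field_simp
  have h1 : 1 + y / (k + 1) ≠ 0 := fun h0 => h (by rw [e, h0, mul_zero])
  rw [e, cpow_def_of_ne_zero (by rw [← e]; exact h), log_ofReal_mul hk' h1, add_mul, exp_add,
    ← cpow_def_of_ne_zero h1, ofReal_log hk'.le]
  rw [cpow_def_of_ne_zero hk]
  push_cast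
  rfl

/-- The term `k + 1` of the Hurwitz series, minus the first terms of its expansion in `y`. -/
noncomputable def hurwitzTerm (y : ℂ) (J k : ℕ) (s : ℂ) : ℂ :=
  ((k : ℂ) + 1 + y) ^ (-s) -
    ∑ j ∈ Finset.range J, negBinom j s * y ^ j * ((k : ℂ) + 1) ^ (-(s + j))

theorem hurwitzTerm_eq (y s : ℂ) (J k : ℕ) (h : (k : ℂ) + 1 + y ≠ 0) :
    hurwitzTerm y J k s = ((k : ℂ) + 1) ^ (-s) * binomRem J s (y / (k + 1)) := by
  have hk : (k + 1 : ℂ) ≠ 0 := Nat.cast_add_one_ne_zero k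
  rw [hurwitzTerm, binomRem, one_add_div_cpow y s k h, mul_sub, Finset.mul_sum]
  congr 1
  refine Finset.sum_congr rfl fun j _ => ?_
  rw [neg_add, cpow_add _ _ hk, cpow_neg _ (j : ℂ), cpow_natCast, div_pow]
  ring

theorem differentiable_hurwitzTerm (y : ℂ) (J k : ℕ) (h : (k : ℂ) + 1 + y ≠ 0) :
    Differentiable ℂ (hurwitzTerm y J k) := by
  have hk : (k + 1 : ℂ) ≠ 0 := Nat.cast_add_one_ne_zero k
  unfold hurwitzTerm
  refine Differentiable.sub (fun s => ?_) (Differentiable.fun_sum fun j _ => ?_)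
  · exact (differentiableAt_id.neg).const_cpow (Or.inl h)
  · refine ((differentiable_negBinom j).mul_const _).mul fun s => ?_
    exact ((differentiableAt_id.add_const _).neg).const_cpow (Or.inl hk)

/-- The binomial estimate applies only once `‖y / (k + 1)‖ ≤ 1/2`; the finitely many earlier terms
are bounded by compactness. -/
theorem exists_summable_bound_of_eventually {F : ℕ → ℂ → ℂ} (hF : ∀ k, Continuous (F k))
    {K : Set ℂ} (hK : IsCompact K) {u : ℕ → ℝ} (hu : Summable u)
    (h : ∀ᶠ k in atTop, ∀ w ∈ K, ‖F k w‖ ≤ u k) :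
    ∃ v : ℕ → ℝ, Summable v ∧ ∀ k, ∀ w ∈ K, ‖F k w‖ ≤ v k := by
  have hb : ∀ k, ∃ B, ∀ w ∈ K, ‖F k w‖ ≤ B := fun k =>
    hK.exists_bound_of_continuousOn (hF k).continuousOn
  choose B hB using hb
  obtain ⟨N, hN⟩ := eventually_atTop.1 h
  refine ⟨fun k => if k < N then B k else u k, ?_, fun k w hw => ?_⟩
  · refine (summable_congr_cofinite ?_).1 hu
    rw [Nat.cofinite_eq_atTop]
    filter_upwards [eventually_ge_atTop N] with k hk
    simp [not_lt.2 hk]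
  · by_cases hk : k < N
    · simpa [hk] using hB k w hw
    · simpa [hk] using hN k (not_lt.1 hk) w hw

theorem exists_summable_bound_hurwitzTerm {y : ℂ} (hy : ∀ k : ℕ, (k : ℂ) + y ≠ 0) (J : ℕ) {s : ℂ}
    (hs : 1 - (J : ℝ) < s.re) :
    ∃ δ : ℝ, 0 < δ ∧ ∃ v : ℕ → ℝ, Summable v ∧
      ∀ k, ∀ w ∈ Metric.closedBall s δ, ‖hurwitzTerm y J k w‖ ≤ v k := by
  -- Half of the available room, so that `Re w + J ≥ 1 + δ` on the closed ball and the terms are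
  -- `O(k^(-(1 + δ)))`.
  set δ := (s.re - (1 - J)) / 2 with hδ
  have hδ0 : 0 < δ := by linarith
  have hy' : ∀ k : ℕ, (k : ℂ) + 1 + y ≠ 0 := fun k => by exact_mod_cast hy (k + 1)
  obtain ⟨C, hC, hCb⟩ := exists_norm_binomRem_le J (‖s‖ + δ)
  refine ⟨δ, hδ0, exists_summable_bound_of_eventually
    (fun k => (differentiable_hurwitzTerm y J k (hy' k)).continuous)
    (isCompact_closedBall s δ) (u := fun k => C * ‖y‖ ^ J * (1 / ((k + 1 : ℕ) : ℝ) ^ (1 + δ)))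
    ?_ ?_⟩
  · refine Summable.mul_left _ ?_
    exact (summable_nat_add_iff 1).2 (Real.summable_one_div_nat_rpow.2 (by linarith))
  · have hN : ∀ᶠ k : ℕ in atTop, 2 * ‖y‖ ≤ (k : ℝ) :=
      tendsto_natCast_atTop_atTop.eventually_ge_atTop _
    filter_upwards [hN] with k hk w hw
    have hk0 : (0 : ℝ) < k + 1 := by positivity
    have hws : ‖w - s‖ ≤ δ := by simpa [dist_eq_norm] using hw
    have hu : ‖y / (k + 1)‖ ≤ 1 / 2 := by
      rw [norm_div, show (k + 1 : ℂ) = ((k + 1 : ℝ) : ℂ) by push_cast; rfl, norm_real,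
        Real.norm_of_nonneg hk0.le, div_le_iff₀ hk0]
      linarith
    have hwn : ‖w‖ ≤ ‖s‖ + δ := by
      calc ‖w‖ = ‖s + (w - s)‖ := by congr 1; ring
        _ ≤ _ := (norm_add_le _ _).trans (by linarith)
    have hre : s.re - δ ≤ w.re := by
      have := (abs_le.1 ((abs_re_le_norm (w - s)).trans hws)).1
      simp only [sub_re] at this
      linarith
    rw [hurwitzTerm_eq y w J k (hy' k), norm_mul]
    have h1 : ‖((k : ℂ) + 1) ^ (-w)‖ = ((k : ℝ) + 1) ^ (-w.re) := by
      rw [show (k + 1 : ℂ) = ((k + 1 : ℝ) : ℂ) by push_cast; rfl,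
        norm_cpow_eq_rpow_re_of_pos hk0, neg_re]
    have h2 : ((k : ℝ) + 1) ^ (-w.re) ≤ ((k : ℝ) + 1) ^ (-(1 + δ) + J) := by
      refine Real.rpow_le_rpow_of_exponent_le (by linarith [(k.cast_nonneg : (0 : ℝ) ≤ k)]) ?_
      linarith
    have h3 := hCb w hwn _ hu
    rw [norm_div, show (k + 1 : ℂ) = ((k + 1 : ℝ) : ℂ) by push_cast; rfl, norm_real,
      Real.norm_of_nonneg hk0.le] at h3
    rw [h1]
    push_cast
    push_cast at h3
    calc _ ≤ ((k : ℝ) + 1) ^ (-(1 + δ) + J) * (C * (‖y‖ / (k + 1)) ^ J) :=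
          mul_le_mul h2 h3 (norm_nonneg _) (by positivity)
      _ = _ := by
        rw [Real.rpow_add hk0, Real.rpow_neg hk0.le, Real.rpow_natCast, div_pow]
        field_simp

theorem differentiableAt_tsum_hurwitzTerm {y : ℂ} (hy : ∀ k : ℕ, (k : ℂ) + y ≠ 0) (J : ℕ) {s : ℂ}
    (hs : 1 - (J : ℝ) < s.re) :
    DifferentiableAt ℂ (fun w => ∑' k, hurwitzTerm y J k w) s := by
  obtain ⟨δ, hδ, v, hv, h⟩ := exists_summable_bound_hurwitzTerm hy J hs
  exact (differentiableOn_tsum_of_summable_norm hv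
    (fun k => (differentiable_hurwitzTerm y J k (by exact_mod_cast hy (k + 1))).differentiableOn)
    Metric.isOpen_ball fun k w hw => h k w (Metric.ball_subset_closedBall hw)).differentiableAt
    (Metric.ball_mem_nhds s hδ)

theorem summable_hurwitzTerm {y : ℂ} (hy : ∀ k : ℕ, (k : ℂ) + y ≠ 0) (J : ℕ) {s : ℂ}
    (hs : 1 - (J : ℝ) < s.re) : Summable fun k => hurwitzTerm y J k s := by
  obtain ⟨δ, hδ, v, hv, h⟩ := exists_summable_bound_hurwitzTerm hy J hs
  exact Summable.of_norm_bounded hv fun k => h k s (Metric.mem_closedBall_self hδ.le)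

theorem hasSum_deriv_hurwitzTerm {y : ℂ} (hy : ∀ k : ℕ, (k : ℂ) + y ≠ 0) (J : ℕ) {s : ℂ}
    (hs : 1 - (J : ℝ) < s.re) :
    HasSum (fun k => deriv (hurwitzTerm y J k) s)
      (deriv (fun w => ∑' k, hurwitzTerm y J k w) s) := by
  obtain ⟨δ, hδ, v, hv, h⟩ := exists_summable_bound_hurwitzTerm hy J hs
  exact hasSum_deriv_of_summable_norm hv
    (fun k => (differentiable_hurwitzTerm y J k (by exact_mod_cast hy (k + 1))).differentiableOn)
    Metric.isOpen_ball (fun k w hw => h k w (Metric.ball_subset_closedBall hw))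
    (Metric.mem_ball_self hδ)

theorem summable_hurwitz {y : ℂ} (hy : ∀ k : ℕ, (k : ℂ) + y ≠ 0) {s : ℂ} (hs : 1 < s.re) :
    Summable fun k : ℕ => ((k : ℂ) + y) ^ (-s) := by
  refine (summable_nat_add_iff 1).1 ?_
  have := summable_hurwitzTerm hy 0 (s := s) (by simpa using hs)
  simpa [hurwitzTerm] using this

theorem hasSum_riemannZeta {s : ℂ} (hs : 1 < s.re) :
    HasSum (fun k : ℕ => ((k : ℂ) + 1) ^ (-s)) (riemannZeta s) := by
  have h := summable_hurwitz (y := 1) (fun k => Nat.cast_add_one_ne_zero k) hs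
  rw [zeta_eq_tsum_one_div_nat_add_one_cpow hs]
  simpa [cpow_neg] using h.hasSum

/-- `(s - 1) ζ(s, y)` in the half plane `Re s > -J`. -/
noncomputable def hurwitzPartial (y : ℂ) (J : ℕ) (s : ℂ) : ℂ :=
  (s - 1) * (y ^ (-s) + ∑' k, hurwitzTerm y (J + 1) k s) + riemannZeta₁ s +
    (s - 1) * ∑ j ∈ Finset.range J,
      -(negBinom j s / (j + 1)) * y ^ (j + 1) * riemannZeta₁ (s + j + 1)

/-- The pole of `ζ(s + j + 1)` at `s = -j` is cancelled by the factor `s + j` of the binomial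
coefficient, which the definition merges into the entire function `riemannZeta₁`. Only the pole at
`s = 1` is left, and it is removed by the factor `s - 1`. -/
theorem differentiableAt_hurwitzPartial {y : ℂ} (hy : ∀ k : ℕ, (k : ℂ) + y ≠ 0) (J : ℕ) {s : ℂ}
    (hs : -(J : ℝ) < s.re) : DifferentiableAt ℂ (hurwitzPartial y J) s := by
  have hy0 : y ≠ 0 := by simpa using hy 0
  have h1 := differentiableAt_tsum_hurwitzTerm hy (J + 1) (s := s) (by push_cast; linarith)
  have h2 : DifferentiableAt ℂ (fun s => y ^ (-s)) s := differentiableAt_id.neg.const_cpow (Or.inl hy0)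
  have h3 := differentiable_riemannZeta₁
  have h4 : DifferentiableAt ℂ (fun s => ∑ j ∈ Finset.range J,
      -(negBinom j s / (j + 1)) * y ^ (j + 1) * riemannZeta₁ (s + j + 1)) s := by
    refine DifferentiableAt.fun_sum fun j _ => ?_
    have := differentiable_negBinom j
    fun_prop
  unfold hurwitzPartial
  fun_prop

theorem riemannZeta₁_eq_mul {s : ℂ} (hs : s ≠ 1) : riemannZeta₁ s = (s - 1) * riemannZeta s := by
  rw [riemannZeta_eq_inv_sub_mul hs, mul_inv_cancel_left₀ (sub_ne_zero.2 hs)]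

theorem hurwitzPartial_eq {y : ℂ} (hy : ∀ k : ℕ, (k : ℂ) + y ≠ 0) (J : ℕ) {s : ℂ}
    (hs : 1 < s.re) : hurwitzPartial y J s = (s - 1) * ∑' k : ℕ, ((k : ℂ) + y) ^ (-s) := by
  have hne : ∀ j : ℕ, s + j ≠ 1 := fun j h => by
    have := congrArg re h
    simp at this
    linarith [(j.cast_nonneg : (0 : ℝ) ≤ j)]
  have hJ : HasSum (fun k : ℕ => ∑ j ∈ Finset.range (J + 1),
      negBinom j s * y ^ j * ((k : ℂ) + 1) ^ (-(s + j)))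
      (∑ j ∈ Finset.range (J + 1), negBinom j s * y ^ j * riemannZeta (s + j)) := by
    refine hasSum_sum fun j _ => (hasSum_riemannZeta ?_).mul_left _
    simp only [add_re, natCast_re]
    linarith [(j.cast_nonneg : (0 : ℝ) ≤ j)]
  have hs' : 1 - ((J + 1 : ℕ) : ℝ) < s.re := by
    push_cast
    linarith [(J.cast_nonneg : (0 : ℝ) ≤ J)]
  have hD := (summable_hurwitzTerm hy (J + 1) hs').hasSum.add hJ
  have hS := (hasSum_nat_add_iff' (f := fun k : ℕ => ((k : ℂ) + y) ^ (-s)) 1).2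
    (summable_hurwitz hy hs).hasSum
  have heq := hS.unique (by
    refine hD.congr_fun ?_
    intro k
    simp [hurwitzTerm])
  simp only [Finset.range_one, Finset.sum_singleton, Nat.cast_zero, zero_add] at heq
  rw [sub_eq_iff_eq_add] at heq
  rw [heq, hurwitzPartial, Finset.sum_range_succ']
  have h0 := riemannZeta₁_eq_mul (by simpa using hne 0 : s ≠ 1)
  have h1 : ∀ j ∈ Finset.range J, -(negBinom j s / (j + 1)) * y ^ (j + 1) * riemannZeta₁ (s + j + 1)
      = negBinom (j + 1) s * y ^ (j + 1) * riemannZeta (s + (j + 1 : ℕ)) := by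
    intro j _
    rw [riemannZeta₁_eq_mul (by simpa [add_assoc] using hne (j + 1)), negBinom_succ]
    push_cast
    rw [add_assoc]
    ring
  rw [Finset.sum_congr rfl h1, h0]
  simp [negBinom]
  ring

/-- Both sides continue the same series from `Re s > 1`, so they agree on the smaller of the two
half planes. This lets the truncation order vary with `s` in a global definition. -/
theorem hurwitzPartial_eq_hurwitzPartial {y : ℂ} (hy : ∀ k : ℕ, (k : ℂ) + y ≠ 0) {J J' : ℕ} {s : ℂ}
    (hs : -(J : ℝ) < s.re) (hs' : -(J' : ℝ) < s.re) :
    hurwitzPartial y J s = hurwitzPartial y J' s := by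
  wlog hJ : J ≤ J' generalizing J J'
  · exact (this hs' hs (by omega)).symm
  have hJ' : (J : ℝ) ≤ J' := by exact_mod_cast hJ
  have hopen : IsOpen {w : ℂ | -(J : ℝ) < w.re} := isOpen_lt continuous_const continuous_re
  have hpre : IsPreconnected {w : ℂ | -(J : ℝ) < w.re} :=
    (convex_halfSpace_re_gt _).isPreconnected
  have hf : AnalyticOnNhd ℂ (hurwitzPartial y J) {w : ℂ | -(J : ℝ) < w.re} :=
    DifferentiableOn.analyticOnNhd
      (fun w hw => (differentiableAt_hurwitzPartial hy J hw).differentiableWithinAt) hopen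
  have hg : AnalyticOnNhd ℂ (hurwitzPartial y J') {w : ℂ | -(J : ℝ) < w.re} :=
    DifferentiableOn.analyticOnNhd
      (fun w hw => (differentiableAt_hurwitzPartial hy J'
        (by have : -(J : ℝ) < w.re := hw
            linarith)).differentiableWithinAt) hopen
  refine hf.eqOn_of_preconnected_of_eventuallyEq hg hpre (z₀ := 2) ?_ ?_ hs
  · simp only [mem_ofPred_eq, re_ofNat]
    linarith [(J.cast_nonneg : (0 : ℝ) ≤ J)]
  · have : {w : ℂ | 1 < w.re} ∈ 𝓝 (2 : ℂ) :=
      (isOpen_lt continuous_const continuous_re).mem_nhds (by simp)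
    filter_upwards [this] with w hw
    rw [hurwitzPartial_eq hy J hw, hurwitzPartial_eq hy J' hw]

/-- The Hurwitz zeta function `ζ(s, y)` for a complex number `y ∉ {0, -1, -2, …}`. -/
noncomputable def complexHurwitz (y s : ℂ) : ℂ :=
  hurwitzPartial y (⌊-s.re⌋₊ + 1) s / (s - 1)

theorem complexHurwitz_eq_partial {y : ℂ} (hy : ∀ k : ℕ, (k : ℂ) + y ≠ 0) {J : ℕ} {s : ℂ}
    (hs : -(J : ℝ) < s.re) : complexHurwitz y s = hurwitzPartial y J s / (s - 1) := by
  rw [complexHurwitz, hurwitzPartial_eq_hurwitzPartial hy _ hs]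
  have := Nat.lt_floor_add_one (-s.re)
  push_cast
  linarith

theorem differentiableAt_complexHurwitz {y : ℂ} (hy : ∀ k : ℕ, (k : ℂ) + y ≠ 0) {s : ℂ}
    (hs : s ≠ 1) : DifferentiableAt ℂ (complexHurwitz y) s := by
  obtain ⟨J, hJ⟩ := exists_nat_gt (-s.re)
  have hJ' : -(J : ℝ) < s.re := by linarith
  have h : DifferentiableAt ℂ (fun w => hurwitzPartial y J w / (w - 1)) s :=
    (differentiableAt_hurwitzPartial hy J hJ').div (by fun_prop) (sub_ne_zero.2 hs)
  refine h.congr_of_eventuallyEq ?_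
  filter_upwards [(isOpen_lt continuous_const continuous_re).mem_nhds hJ'] with w hw
  exact complexHurwitz_eq_partial hy hw

theorem complexHurwitz_eq_tsum {y : ℂ} (hy : ∀ k : ℕ, (k : ℂ) + y ≠ 0) {s : ℂ}
    (hs : 1 < s.re) : complexHurwitz y s = ∑' k : ℕ, ((k : ℂ) + y) ^ (-s) := by
  have h1 : s ≠ 1 := fun h => by simp [h] at hs
  rw [complexHurwitz_eq_partial hy (J := 0) (by simp; linarith), hurwitzPartial_eq hy 0 hs,
    mul_div_cancel_left₀ _ (sub_ne_zero.2 h1)]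

/-- The expansion of `ζ(s, y)` near `s = 0`. -/
theorem complexHurwitz_eq_near_zero {y : ℂ} (hy : ∀ k : ℕ, (k : ℂ) + y ≠ 0) {s : ℂ}
    (hs : -1 < s.re) (hs1 : s ≠ 1) :
    complexHurwitz y s = y ^ (-s) + ∑' k, hurwitzTerm y 2 k s + riemannZeta s -
      y * riemannZeta₁ (s + 1) := by
  rw [complexHurwitz_eq_partial hy (J := 1) (by simpa using hs), hurwitzPartial]
  simp only [Finset.range_one, Finset.sum_singleton, Nat.cast_zero]
  rw [riemannZeta₁_eq_mul hs1, div_eq_iff (sub_ne_zero.2 hs1)]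
  simp [negBinom]
  ring

/-- This value is odd under `y ↦ 1 - y`, so the scale `(2π)^(-s)` drops out of the reflection
formula for `logGamma 1`. -/
theorem complexHurwitz_zero {y : ℂ} (hy : ∀ k : ℕ, (k : ℂ) + y ≠ 0) :
    complexHurwitz y 0 = 1 / 2 - y := by
  rw [complexHurwitz_eq_near_zero hy (by simp) zero_ne_one, riemannZeta_zero]
  simp [hurwitzTerm, Finset.sum_range_succ, negBinom]
  ring

theorem deriv_hurwitzTerm_two {y : ℂ} {k : ℕ} (h : (k : ℂ) + 1 + y ≠ 0) :
    deriv (hurwitzTerm y 2 k) 0 = -log (k + 1 + y) + log (k + 1) + y / (k + 1) := by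
  have hk : (k + 1 : ℂ) ≠ 0 := Nat.cast_add_one_ne_zero k
  have e : hurwitzTerm y 2 k = fun s : ℂ => ((k : ℂ) + 1 + y) ^ (-s) -
      (((k : ℂ) + 1) ^ (-s) + -s * y * ((k : ℂ) + 1) ^ (-(s + 1))) := by
    funext s
    simp [hurwitzTerm, Finset.sum_range_succ, negBinom]
  have h1 := (hasDerivAt_id (0 : ℂ)).neg.const_cpow (c := (k : ℂ) + 1 + y) (Or.inl h)
  have h2 := (hasDerivAt_id (0 : ℂ)).neg.const_cpow (c := (k : ℂ) + 1) (Or.inl hk)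
  have h3 := ((hasDerivAt_id (0 : ℂ)).add_const 1).neg.const_cpow (c := (k : ℂ) + 1) (Or.inl hk)
  have h4 := ((hasDerivAt_id (0 : ℂ)).neg.mul_const y).mul h3
  rw [e]
  refine ((h1.sub (h2.add h4)).congr_deriv ?_).deriv
  simp [cpow_neg]
  ring

/-- The logarithm of the Weierstrass product of the gamma function. The sum `D` and the coefficient
of `y` need no evaluation: the first is paired with its value at `-y`, and the linear terms then
cancel. -/
theorem hasDerivAt_complexHurwitz_zero {y : ℂ} (hy : ∀ k : ℕ, (k : ℂ) + y ≠ 0) :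
    ∃ D : ℂ, HasSum (fun k : ℕ => -log (k + 1 + y) + log (k + 1) + y / (k + 1)) D ∧
      HasDerivAt (complexHurwitz y)
        (-log y + D + deriv riemannZeta 0 - y * deriv riemannZeta₁ 1) 0 := by
  have hy0 : y ≠ 0 := by simpa using hy 0
  refine ⟨deriv (fun w => ∑' k, hurwitzTerm y 2 k w) 0, ?_, ?_⟩
  · refine (hasSum_deriv_hurwitzTerm hy 2 (s := 0) (by norm_num)).congr_fun fun k => ?_
    exact (deriv_hurwitzTerm_two (by exact_mod_cast hy (k + 1))).symm
  · have h1 := (hasDerivAt_id (0 : ℂ)).neg.const_cpow (c := y) (Or.inl hy0)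
    have h2 := (differentiableAt_tsum_hurwitzTerm hy 2 (s := 0) (by norm_num)).hasDerivAt
    have h3 := (differentiableAt_riemannZeta zero_ne_one).hasDerivAt
    have h4 : HasDerivAt (fun s : ℂ => riemannZeta₁ (s + 1)) (deriv riemannZeta₁ 1) 0 := by
      have := (differentiable_riemannZeta₁ ((0 : ℂ) + 1)).hasDerivAt.comp_add_const 0 1
      simpa using this
    refine (((h1.add h2).add h3).sub (h4.const_mul y)).congr_of_eventuallyEq ?_ |>.congr_deriv ?_
    · have m1 : {s : ℂ | -1 < s.re} ∈ 𝓝 (0 : ℂ) :=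
        (isOpen_lt continuous_const continuous_re).mem_nhds (by simp)
      have m2 : {s : ℂ | s ≠ 1} ∈ 𝓝 (0 : ℂ) := isOpen_ne.mem_nhds zero_ne_one
      filter_upwards [m1, m2] with s hs hs1
      simpa using complexHurwitz_eq_near_zero hy hs hs1
    · simp

/-! ### Uniqueness of the continuation, the unit shift and the reflection formula -/

/-- The complement of the possible poles `1, …, r`. -/
def zetaDomain (r : ℕ) : Set ℂ := {s : ℂ | ∀ m : ℕ, 1 ≤ m → m ≤ r → s ≠ (m : ℂ)}

theorem zetaDomain_eq (r : ℕ) :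
    zetaDomain r = ((↑) '' (Finset.Icc 1 r : Set ℕ) : Set ℂ)ᶜ := by
  ext s
  simp only [zetaDomain, mem_ofPred_eq, mem_compl_iff, mem_image, Finset.coe_Icc, mem_Icc,
    not_exists, not_and, and_imp]
  exact ⟨fun h m h1 h2 e => h m h1 h2 e.symm, fun h m h1 h2 e => h m h1 h2 e.symm⟩

theorem isOpen_zetaDomain (r : ℕ) : IsOpen (zetaDomain r) := by
  rw [zetaDomain_eq]
  exact ((Finset.finite_toSet _).image _).isClosed.isOpen_compl

theorem isPreconnected_zetaDomain (r : ℕ) : IsPreconnected (zetaDomain r) := by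
  rw [zetaDomain_eq]
  exact (((Finset.finite_toSet _).image _).countable.isConnected_compl_of_one_lt_rank
    (by simp)).isPreconnected

theorem zero_mem_zetaDomain (r : ℕ) : (0 : ℂ) ∈ zetaDomain r := fun m h1 _ h => by
  have : m = 0 := by exact_mod_cast h.symm
  omega

theorem mem_zetaDomain_of_lt_re {r : ℕ} {s : ℂ} (hs : (r : ℝ) < s.re) : s ∈ zetaDomain r := by
  intro m _ h2 h
  rw [h, natCast_re] at hs
  have : (m : ℝ) ≤ r := by exact_mod_cast h2
  linarith

/-- The plane minus finitely many points is connected, so the identity theorem applies. -/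
theorem eqOn_zetaDomain {r : ℕ} {f g : ℂ → ℂ} (hf : DifferentiableOn ℂ f (zetaDomain r))
    (hg : DifferentiableOn ℂ g (zetaDomain r)) (h : ∀ s : ℂ, (r : ℝ) < s.re → f s = g s) :
    EqOn f g (zetaDomain r) := by
  have hlt : (r : ℝ) < ((r : ℂ) + 1).re := by simp
  refine (hf.analyticOnNhd (isOpen_zetaDomain r)).eqOn_of_preconnected_of_eventuallyEq
    (hg.analyticOnNhd (isOpen_zetaDomain r)) (isPreconnected_zetaDomain r)
    (z₀ := (r : ℂ) + 1) (mem_zetaDomain_of_lt_re hlt) ?_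
  filter_upwards [(isOpen_lt continuous_const continuous_re).mem_nhds hlt] with w hw using h w hw

theorem deriv_eq_of_eqOn_zetaDomain {r : ℕ} {f g : ℂ → ℂ} (h : EqOn f g (zetaDomain r)) :
    deriv f 0 = deriv g 0 :=
  (h.eventuallyEq_of_mem ((isOpen_zetaDomain r).mem_nhds (zero_mem_zetaDomain r))).deriv_eq

theorem zetaDomain_one : zetaDomain 1 = {1}ᶜ := by
  rw [zetaDomain_eq]
  simp

theorem add_one_lattice {y : ℂ} (hy : ∀ k : ℕ, (k : ℂ) + y ≠ 0) (k : ℕ) :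
    (k : ℂ) + (y + 1) ≠ 0 := by
  have := hy (k + 1)
  push_cast at this
  rwa [add_assoc, add_comm 1 y] at this

theorem complexHurwitz_add_one {y : ℂ} (hy : ∀ k : ℕ, (k : ℂ) + y ≠ 0) {s : ℂ} (hs : s ≠ 1) :
    complexHurwitz (y + 1) s = complexHurwitz y s - y ^ (-s) := by
  have hy0 : y ≠ 0 := by simpa using hy 0
  have hy1 := add_one_lattice hy
  have h := eqOn_zetaDomain (r := 1) (f := complexHurwitz (y + 1))
    (g := fun s => complexHurwitz y s - y ^ (-s)) ?_ ?_ ?_ (by rwa [zetaDomain_one])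
  · exact h
  · rw [zetaDomain_one]
    exact fun s hs => (differentiableAt_complexHurwitz hy1 hs).differentiableWithinAt
  · rw [zetaDomain_one]
    exact fun s hs => ((differentiableAt_complexHurwitz hy hs).sub
      (differentiableAt_id.neg.const_cpow (Or.inl hy0))).differentiableWithinAt
  · intro s hs
    rw [Nat.cast_one] at hs
    rw [complexHurwitz_eq_tsum hy1 hs, complexHurwitz_eq_tsum hy hs,
      (summable_hurwitz hy hs).tsum_eq_zero_add]
    simp [add_assoc, add_comm 1 y]

theorem deriv_complexHurwitz_add_one {y : ℂ} (hy : ∀ k : ℕ, (k : ℂ) + y ≠ 0) :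
    deriv (complexHurwitz (y + 1)) 0 = deriv (complexHurwitz y) 0 + log y := by
  have hy0 : y ≠ 0 := by simpa using hy 0
  have e : complexHurwitz (y + 1) =ᶠ[𝓝 0] fun s => complexHurwitz y s - y ^ (-s) := by
    filter_upwards [isOpen_ne.mem_nhds (zero_ne_one (α := ℂ))] with s hs
      using complexHurwitz_add_one hy hs
  have h1 := (hasDerivAt_id (0 : ℂ)).neg.const_cpow (c := y) (Or.inl hy0)
  have h2 := (differentiableAt_complexHurwitz hy zero_ne_one).hasDerivAt
  rw [e.deriv_eq]
  refine ((h2.sub h1).congr_deriv ?_).deriv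
  simp

/-- The reflection formula for `∂ₛ ζ(0, y)`. -/
theorem exp_deriv_complexHurwitz_reflection {y : ℂ} (hy : ∀ k : ℤ, (k : ℂ) + y ≠ 0) :
    exp (deriv (complexHurwitz y) 0 + deriv (complexHurwitz (1 - y)) 0) =
      1 / (2 * sin (Real.pi * y)) := by
  have hy1 : ∀ k : ℕ, (k : ℂ) + y ≠ 0 := fun k => by exact_mod_cast hy k
  have hy2 : ∀ k : ℕ, (k : ℂ) + -y ≠ 0 := fun k h => hy (-k) (by
    push_cast
    linear_combination -h)
  have hy0 : y ≠ 0 := by simpa using hy1 0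
  obtain ⟨D, hD, hD'⟩ := hasDerivAt_complexHurwitz_zero hy1
  obtain ⟨E, hE, hE'⟩ := hasDerivAt_complexHurwitz_zero hy2
  have hπ : (Real.pi : ℂ) ≠ 0 := ofReal_ne_zero.2 Real.pi_ne_zero
  have hlim : Tendsto (fun n : ℕ => exp (∑ k ∈ Finset.range n,
      ((-log (k + 1 + y) + log (k + 1) + y / (k + 1)) +
        (-log (k + 1 + -y) + log (k + 1) + -y / (k + 1))))) atTop (𝓝 (exp (D + E))) :=
    (continuous_exp.tendsto _).comp (hD.add hE).tendsto_sum_nat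
  -- The convergence terms `± y / (k + 1)` cancel, and each exponentiated summand is the inverse of
  -- one factor of Euler's sine product.
  have hprod : ∀ n : ℕ, exp (∑ k ∈ Finset.range n,
      ((-log (k + 1 + y) + log (k + 1) + y / (k + 1)) +
        (-log (k + 1 + -y) + log (k + 1) + -y / (k + 1)))) *
      (Real.pi * y * ∏ j ∈ Finset.range n, (1 - y ^ 2 / ((j : ℂ) + 1) ^ 2)) = Real.pi * y := by
    intro n
    rw [exp_sum, mul_left_comm, ← Finset.prod_mul_distrib, Finset.prod_eq_one, mul_one]
    intro k _
    have hk : (k + 1 : ℂ) ≠ 0 := Nat.cast_add_one_ne_zero k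
    have ha : (k : ℂ) + 1 + y ≠ 0 := by exact_mod_cast hy1 (k + 1)
    have hb : (k : ℂ) + 1 + -y ≠ 0 := by exact_mod_cast hy2 (k + 1)
    have e : (-log (k + 1 + y) + log (k + 1) + y / (k + 1)) +
        (-log (k + 1 + -y) + log (k + 1) + -y / (k + 1)) =
        log (k + 1) + log (k + 1) - log (k + 1 + y) - log (k + 1 + -y) := by ring
    rw [e, exp_sub, exp_sub, exp_add, exp_log hk, exp_log ha, exp_log hb]
    field_simp
    ring
  have hsin : exp (D + E) * sin (Real.pi * y) = Real.pi * y := by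
    refine tendsto_nhds_unique (hlim.mul (tendsto_euler_sin_prod y)) ?_
    simp_rw [hprod]
    exact tendsto_const_nhds
  have hsin0 : sin (Real.pi * y) ≠ 0 := fun h => by
    rw [h, mul_zero] at hsin
    exact mul_ne_zero hπ hy0 hsin.symm
  -- The expansions available are those at `y` and `-y`, so `1 - y` is reached by one unit shift;
  -- its `log (-y)` removes the one in the expansion at `-y`.
  rw [show 1 - y = -y + 1 by ring, deriv_complexHurwitz_add_one hy2, hD'.deriv, hE'.deriv]
  rw [deriv_riemannZeta_zero]
  have e : -log y + D + -log (2 * Real.pi) / 2 - y * deriv riemannZeta₁ 1 +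
      (-log (-y) + E + -log (2 * Real.pi) / 2 - -y * deriv riemannZeta₁ 1 + log (-y)) =
      (D + E) - log y - log (2 * Real.pi) := by ring
  rw [e, exp_sub, exp_sub, exp_log hy0, exp_log (mul_ne_zero two_ne_zero hπ)]
  rw [eq_div_iff (mul_ne_zero two_ne_zero hsin0)]
  generalize sin (Real.pi * y) = σ at hsin
  field_simp
  linear_combination hsin

/-! ### Multiple Hurwitz zeta functions with equal periods -/

theorem card_fiber_sum (r m : ℕ) [Fintype {k : Fin r → ℕ // ∑ i, k i = m}] :
    Fintype.card {k : Fin r → ℕ // ∑ i, k i = m} = r.multichoose m := by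
  rw [← Fintype.card_congr (Sym.equivNatSumOfFintype (Fin r) m), Sym.card_sym_eq_multichoose,
    Fintype.card_fin]

/-- Grouping the multi-indices by their total `m`: by stars and bars each group has `r.multichoose
m` members. -/
theorem hasSum_comp_sum (r : ℕ) {g : ℕ → ℂ}
    (hg : Summable fun m : ℕ => (r.multichoose m : ℂ) * g m) :
    HasSum (fun k : Fin r → ℕ => g (∑ i, k i)) (∑' m : ℕ, (r.multichoose m : ℂ) * g m) := by
  have hfin : ∀ m, Finite {k : Fin r → ℕ // ∑ i, k i = m} := fun m =>
    Finite.of_equiv _ (Sym.equivNatSumOfFintype (Fin r) m)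
  have : ∀ m, Fintype {k : Fin r → ℕ // ∑ i, k i = m} := fun m => Fintype.ofFinite _
  refine (Equiv.sigmaFiberEquiv fun k : Fin r → ℕ => ∑ i, k i).hasSum_iff.1 ?_
  have hcomp : ∀ x : (Σ m : ℕ, {k : Fin r → ℕ // ∑ i, k i = m}),
      ((fun k : Fin r → ℕ => g (∑ i, k i)) ∘ Equiv.sigmaFiberEquiv fun k : Fin r → ℕ => ∑ i, k i) x
        = g x.1 := by
    rintro ⟨m, k, hk⟩
    simp [Equiv.sigmaFiberEquiv, hk]
  rw [funext hcomp]
  refine HasSum.sigma_of_hasSum hg.hasSum (fun m => ?_) (Summable.of_norm ?_)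
  · have := hasSum_fintype fun _ : {k : Fin r → ℕ // ∑ i, k i = m} => g m
    simpa [card_fiber_sum] using this
  · refine (summable_sigma_of_nonneg fun x => norm_nonneg _).2
      ⟨fun m => (hasSum_fintype _).summable, ?_⟩
    refine hg.norm.congr fun m => ?_
    simp [tsum_fintype, card_fiber_sum]

/-- `ζ₁(s, y | 1)`, `ζ₂(s, y | 1, 1)` and `ζ₃(s, y | 1, 1, 1)` through Hurwitz zeta functions. -/
noncomputable def unitZeta (r : ℕ) (y s : ℂ) : ℂ :=
  match r with
  | 1 => complexHurwitz y s
  | 2 => complexHurwitz y (s - 1) + (1 - y) * complexHurwitz y s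
  | 3 => (complexHurwitz y (s - 2) + (3 - 2 * y) * complexHurwitz y (s - 1) +
      (1 - y) * (2 - y) * complexHurwitz y s) / 2
  | _ => 0

theorem differentiableAt_complexHurwitz_sub {y : ℂ} (hy : ∀ k : ℕ, (k : ℂ) + y ≠ 0) {r : ℕ} (j : ℕ)
    (hj : j + 1 ≤ r) {s : ℂ} (hs : s ∈ zetaDomain r) :
    DifferentiableAt ℂ (fun s => complexHurwitz y (s - j)) s := by
  refine DifferentiableAt.comp (g := complexHurwitz y) s
    (differentiableAt_complexHurwitz hy fun h => ?_) (by fun_prop)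
  refine hs (j + 1) (by omega) hj ?_
  push_cast
  linear_combination h

theorem differentiableAt_unitZeta {y : ℂ} (hy : ∀ k : ℕ, (k : ℂ) + y ≠ 0) (r : ℕ) {s : ℂ}
    (hs : s ∈ zetaDomain r) : DifferentiableAt ℂ (unitZeta r y) s := by
  have h := fun j hj => differentiableAt_complexHurwitz_sub hy (r := r) j hj hs
  match r, h with
  | 0, _ => exact differentiableAt_const _
  | 1, h =>
    have h0 := h 0 (by omega)
    simp only [Nat.cast_zero, sub_zero] at h0
    exact h0
  | 2, h =>
    have h0 := h 0 (by omega)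
    have h1 := h 1 (by omega)
    simp only [Nat.cast_zero, sub_zero, Nat.cast_one] at h0 h1
    exact h1.add (h0.const_mul _)
  | 3, h =>
    have h0 := h 0 (by omega)
    have h1 := h 1 (by omega)
    have h2 := h 2 (by omega)
    simp only [Nat.cast_zero, sub_zero, Nat.cast_one, Nat.cast_ofNat] at h0 h1 h2
    exact ((h2.add (h1.const_mul _)).add (h0.const_mul _)).div_const 2
  | _ + 4, _ => exact differentiableAt_const _

theorem hasSum_complexHurwitz_sub {y : ℂ} (hy : ∀ k : ℕ, (k : ℂ) + y ≠ 0) (j : ℕ) {s : ℂ}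
    (hs : (j : ℝ) + 1 < s.re) :
    HasSum (fun m : ℕ => ((m : ℂ) + y) ^ j * ((m : ℂ) + y) ^ (-s)) (complexHurwitz y (s - j)) := by
  have hs' : 1 < (s - j).re := by
    simp only [sub_re, natCast_re]
    linarith
  rw [complexHurwitz_eq_tsum hy hs']
  refine (summable_hurwitz hy hs').hasSum.congr_fun fun m => ?_
  rw [show -(s - j) = (j : ℂ) + -s by ring, cpow_add _ _ (hy m), cpow_natCast]

theorem multichoose_three (m : ℕ) : ((Nat.multichoose 3 m : ℕ) : ℂ) = (m + 1) * (m + 2) / 2 := by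
  induction m with
  | zero => simp
  | succ m ih =>
    rw [Nat.multichoose_succ_succ, Nat.multichoose_two]
    push_cast
    rw [ih]
    ring

/-- The multiplicity is a polynomial in `m`; expanded in powers of `m + y`, for instance `m + 1 = (m
+ y) + (1 - y)`, it yields the coefficients of `unitZeta`. -/
theorem hasSum_unitZeta {y : ℂ} (hy : ∀ k : ℕ, (k : ℂ) + y ≠ 0) {r : ℕ} (hr : r ∈ Finset.Icc 1 3)
    {s : ℂ} (hs : (r : ℝ) < s.re) :
    HasSum (fun m : ℕ => (r.multichoose m : ℂ) * ((m : ℂ) + y) ^ (-s)) (unitZeta r y s) := by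
  have h := fun j hj => hasSum_complexHurwitz_sub hy (s := s) j hj
  obtain ⟨h1, h3⟩ := Finset.mem_Icc.1 hr
  interval_cases r
  · simpa [unitZeta] using h 0 (by simpa using hs)
  · have a0 := h 0 (by norm_num at hs ⊢; linarith)
    have a1 := h 1 (by norm_num at hs ⊢; linarith)
    simp only [Nat.cast_zero, sub_zero, Nat.cast_one] at a0 a1
    refine (a1.add (a0.mul_left (1 - y))).congr_fun fun m => ?_
    rw [Nat.multichoose_two]
    push_cast
    ring
  · have a0 := h 0 (by norm_num at hs ⊢; linarith)
    have a1 := h 1 (by norm_num at hs ⊢; linarith)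
    have a2 := h 2 (by norm_num at hs ⊢; linarith)
    simp only [Nat.cast_zero, sub_zero, Nat.cast_one, Nat.cast_ofNat] at a0 a1 a2
    refine (((a2.add (a1.mul_left (3 - 2 * y))).add
      (a0.mul_left ((1 - y) * (2 - y)))).div_const 2).congr_fun fun m => ?_
    rw [multichoose_three]
    ring

/-- The ladder between consecutive orders, which is the source of every functional equation of `S₂`
and `S₃` below. -/
theorem unitZeta_add_one {y : ℂ} (hy : ∀ k : ℕ, (k : ℂ) + y ≠ 0) {r : ℕ} (hr : r ∈ Finset.Icc 1 2)
    {s : ℂ} (hs : s ∈ zetaDomain (r + 1)) :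
    unitZeta (r + 1) (y + 1) s = unitZeta (r + 1) y s - unitZeta r y s := by
  have hy0 : y ≠ 0 := by simpa using hy 0
  obtain ⟨h1, h2⟩ := Finset.mem_Icc.1 hr
  have e0 : s ≠ 1 := by simpa using hs 1 (by omega) (by omega)
  have e1 : s - 1 ≠ 1 := fun h => hs 2 (by omega) (by omega) (by push_cast; linear_combination h)
  have p1 : y ^ (-(s - 1)) = y * y ^ (-s) := by
    rw [show -(s - 1) = 1 + -s by ring, cpow_add _ _ hy0, cpow_one]
  interval_cases r
  · simp only [unitZeta, Nat.reduceAdd]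
    rw [complexHurwitz_add_one hy e0, complexHurwitz_add_one hy e1, p1]
    ring
  · have e2 : s - 2 ≠ 1 := fun h => hs 3 (by omega) (by omega) (by push_cast; linear_combination h)
    have p2 : y ^ (-(s - 2)) = y ^ 2 * y ^ (-s) := by
      rw [show -(s - 2) = (2 : ℕ) + -s by push_cast; ring, cpow_add _ _ hy0, cpow_natCast]
    simp only [unitZeta, Nat.reduceAdd]
    rw [complexHurwitz_add_one hy e0, complexHurwitz_add_one hy e1, complexHurwitz_add_one hy e2,
      p1, p2]
    ring

/-- The period vector `(2π, …, 2π)`. -/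
noncomputable def twoPiPeriods (r : ℕ) : Fin r → ℂ := fun _ => ((2 * Real.pi : ℝ) : ℂ)

theorem two_pi_ne_zero' : ((2 * Real.pi : ℝ) : ℂ) ≠ 0 :=
  ofReal_ne_zero.2 Real.two_pi_pos.ne'

theorem latticePoint_twoPiPeriods (r : ℕ) (y : ℂ) (k : Fin r → ℕ) :
    latticePoint (twoPiPeriods r) ((2 * Real.pi : ℝ) * y) k =
      ((2 * Real.pi : ℝ) : ℂ) * (((∑ i, k i : ℕ) : ℂ) + y) := by
  simp only [latticePoint, twoPiPeriods, ← Finset.sum_mul]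
  push_cast
  ring

theorem two_pi_mul_cpow {z : ℂ} (hz : z ≠ 0) (s : ℂ) :
    (((2 * Real.pi : ℝ) : ℂ) * z) ^ s = ((2 * Real.pi : ℝ) : ℂ) ^ s * z ^ s := by
  rw [cpow_def_of_ne_zero (mul_ne_zero two_pi_ne_zero' hz), log_ofReal_mul Real.two_pi_pos hz,
    add_mul, exp_add, ← cpow_def_of_ne_zero hz, ofReal_log Real.two_pi_pos.le,
    ← cpow_def_of_ne_zero two_pi_ne_zero']

theorem isMultipleHurwitzZeta_unitZeta {y : ℂ} (hy : ∀ k : ℕ, (k : ℂ) + y ≠ 0) {r : ℕ}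
    (hr : r ∈ Finset.Icc 1 3) :
    IsMultipleHurwitzZeta (twoPiPeriods r) ((2 * Real.pi : ℝ) * y)
      fun s => ((2 * Real.pi : ℝ) : ℂ) ^ (-s) * unitZeta r y s := by
  refine ⟨fun s hs => ?_, fun s hs => ?_⟩
  · exact ((differentiableAt_id.neg.const_cpow (Or.inl two_pi_ne_zero')).mul
      (differentiableAt_unitZeta hy r hs)).differentiableWithinAt
  · have h := hasSum_unitZeta hy hr hs
    have h' := hasSum_comp_sum r h.summable
    rw [h.tsum_eq] at h'
    refine (h'.mul_left (((2 * Real.pi : ℝ) : ℂ) ^ (-s))).tsum_eq.symm.trans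
      (tsum_congr fun k => ?_)
    rw [latticePoint_twoPiPeriods, two_pi_mul_cpow (hy _)]

/-- The zeta function is defined by choice; uniqueness of the continuation lets any explicit one
replace it. -/
theorem deriv_multipleHurwitzZeta {r : ℕ} {ω : Fin r → ℂ} {x : ℂ} {Z : ℂ → ℂ}
    (hZ : IsMultipleHurwitzZeta ω x Z) : deriv (multipleHurwitzZeta ω x) 0 = deriv Z 0 := by
  have h : IsMultipleHurwitzZeta ω x (multipleHurwitzZeta ω x) := Classical.epsilon_spec ⟨Z, hZ⟩
  exact deriv_eq_of_eqOn_zetaDomain (r := r)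
    (eqOn_zetaDomain h.1 hZ.1 fun s hs => by rw [h.2 s hs, hZ.2 s hs])

/-- `∂ₛ ζ_r(0, 2πy | 2π, …, 2π)`. -/
noncomputable def logGamma (r : ℕ) (y : ℂ) : ℂ :=
  deriv (unitZeta r y) 0 - log ((2 * Real.pi : ℝ) : ℂ) * unitZeta r y 0

theorem multipleGamma_twoPiPeriods {y : ℂ} (hy : ∀ k : ℕ, (k : ℂ) + y ≠ 0) {r : ℕ}
    (hr : r ∈ Finset.Icc 1 3) :
    multipleGamma (twoPiPeriods r) ((2 * Real.pi : ℝ) * y) = exp (logGamma r y) := by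
  have hno : ¬ ∃ k : Fin r → ℕ, latticePoint (twoPiPeriods r) ((2 * Real.pi : ℝ) * y) k = 0 := by
    rintro ⟨k, hk⟩
    rw [latticePoint_twoPiPeriods] at hk
    exact mul_ne_zero two_pi_ne_zero' (hy _) hk
  rw [multipleGamma, if_neg hno, deriv_multipleHurwitzZeta (isMultipleHurwitzZeta_unitZeta hy hr)]
  congr 1
  have h1 := (hasDerivAt_id (0 : ℂ)).neg.const_cpow (c := ((2 * Real.pi : ℝ) : ℂ))
    (Or.inl two_pi_ne_zero')
  have h2 := (differentiableAt_unitZeta hy r (zero_mem_zetaDomain r)).hasDerivAt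
  refine ((h1.mul h2).congr_deriv ?_).deriv
  simp [logGamma]
  ring

theorem logGamma_add_one {y : ℂ} (hy : ∀ k : ℕ, (k : ℂ) + y ≠ 0) {r : ℕ}
    (hr : r ∈ Finset.Icc 1 2) :
    logGamma (r + 1) (y + 1) = logGamma (r + 1) y - logGamma r y := by
  have hD : DifferentiableAt ℂ (unitZeta r y) 0 :=
    differentiableAt_unitZeta hy r (zero_mem_zetaDomain r)
  have hD' : DifferentiableAt ℂ (unitZeta (r + 1) y) 0 :=
    differentiableAt_unitZeta hy (r + 1) (zero_mem_zetaDomain _)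
  have h : EqOn (unitZeta (r + 1) (y + 1)) (fun s => unitZeta (r + 1) y s - unitZeta r y s)
      (zetaDomain (r + 1)) := fun s hs => unitZeta_add_one hy hr hs
  rw [logGamma, logGamma, logGamma, deriv_eq_of_eqOn_zetaDomain h, h (zero_mem_zetaDomain _),
    deriv_fun_sub hD' hD]
  ring

theorem exp_logGamma_one_reflection {y : ℂ} (hy : ∀ k : ℤ, (k : ℂ) + y ≠ 0) :
    exp (logGamma 1 y + logGamma 1 (1 - y)) = 1 / (2 * sin (Real.pi * y)) := by
  have hy1 : ∀ k : ℕ, (k : ℂ) + y ≠ 0 := fun k => by exact_mod_cast hy k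
  have hy2 : ∀ k : ℕ, (k : ℂ) + (1 - y) ≠ 0 := fun k h => hy (-(k + 1)) (by
    push_cast
    linear_combination -h)
  rw [← exp_deriv_complexHurwitz_reflection hy]
  congr 1
  have e : ∀ y, unitZeta 1 y = complexHurwitz y := fun _ => rfl
  simp only [logGamma, e]
  rw [complexHurwitz_zero hy1, complexHurwitz_zero hy2]
  ring

/-! ### The double and triple sine functions with equal periods `2π` -/

/-- `x` is not an integral multiple of `2π`. -/
def OffLattice (x : ℂ) : Prop := ∀ k : ℤ, x ≠ ((2 * Real.pi : ℝ) : ℂ) * k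

theorem offLattice_of_im_ne_zero {x : ℂ} (hx : x.im ≠ 0) : OffLattice x := by
  rintro k rfl
  refine hx ?_
  rw [im_ofReal_mul, intCast_im, mul_zero]

theorem offLattice_of_re {x : ℂ} (m : ℤ) (h1 : 2 * Real.pi * m < x.re)
    (h2 : x.re < 2 * Real.pi * (m + 1)) : OffLattice x := by
  rintro k rfl
  rw [re_ofReal_mul, intCast_re] at h1 h2
  have h1' : m < k := by exact_mod_cast lt_of_mul_lt_mul_left h1 Real.two_pi_pos.le
  have h2' : k < m + 1 := by exact_mod_cast lt_of_mul_lt_mul_left h2 Real.two_pi_pos.le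
  omega

theorem OffLattice.add_two_pi {x : ℂ} (hx : OffLattice x) :
    OffLattice (x + ((2 * Real.pi : ℝ) : ℂ)) := fun k h => hx (k - 1) (by
  push_cast at h ⊢
  linear_combination h)

theorem OffLattice.neg {x : ℂ} (hx : OffLattice x) : OffLattice (-x) := fun k h => hx (-k) (by
  push_cast at h ⊢
  linear_combination -h)

theorem OffLattice.normalized {x : ℂ} (hx : OffLattice x) (k : ℤ) :
    (k : ℂ) + x / ((2 * Real.pi : ℝ) : ℂ) ≠ 0 := fun h => hx (-k) (by
  have h2 := two_pi_ne_zero'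
  field_simp at h
  push_cast at h ⊢
  linear_combination h)

theorem OffLattice.sin_ne_zero {x : ℂ} (hx : OffLattice x) : sin (x / 2) ≠ 0 := by
  intro h
  obtain ⟨k, hk⟩ := Complex.sin_eq_zero_iff.1 h
  refine hx k ?_
  push_cast
  linear_combination 2 * hk

theorem multipleGamma_eq_exp {x : ℂ}
    (hx : ∀ k : ℕ, (k : ℂ) + x / ((2 * Real.pi : ℝ) : ℂ) ≠ 0) {r : ℕ} (hr : r ∈ Finset.Icc 1 3) :
    multipleGamma (twoPiPeriods r) x = exp (logGamma r (x / ((2 * Real.pi : ℝ) : ℂ))) := by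
  rw [← multipleGamma_twoPiPeriods hx hr, mul_div_cancel₀ _ two_pi_ne_zero']

theorem S2_eq (x : ℂ) : S2 (1 / 2) (2 * Real.pi) x =
    (multipleGamma (twoPiPeriods 2) x)⁻¹ *
      multipleGamma (twoPiPeriods 2) (2 * ((2 * Real.pi : ℝ) : ℂ) - x) := by
  have e : (![((2 * Real.pi : ℝ) : ℂ), ((Real.pi / (1 / 2) : ℝ) : ℂ)] : Fin 2 → ℂ) =
      twoPiPeriods 2 := by
    funext i
    fin_cases i
    · simp [twoPiPeriods]
    · simp [twoPiPeriods]
      ring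
  rw [S2, e, multipleSine]
  simp [twoPiPeriods]

theorem S3_eq (x : ℂ) : S3 (1 / 2) (2 * Real.pi) x =
    (multipleGamma (twoPiPeriods 3) x)⁻¹ *
      (multipleGamma (twoPiPeriods 3) (3 * ((2 * Real.pi : ℝ) : ℂ) - x))⁻¹ := by
  have e : (![((2 * Real.pi : ℝ) : ℂ), ((2 * Real.pi : ℝ) : ℂ),
      ((Real.pi / (1 / 2) : ℝ) : ℂ)] : Fin 3 → ℂ) = twoPiPeriods 3 := by
    funext i
    fin_cases i
    · simp [twoPiPeriods]
    · simp [twoPiPeriods]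
    · simp [twoPiPeriods]
      ring
  rw [S3, e, multipleSine]
  simp [twoPiPeriods, show (-1 : ℤ) ^ 3 = -1 by norm_num]

theorem S2_eq_exp {x : ℂ} (hx : OffLattice x) : S2 (1 / 2) (2 * Real.pi) x =
    exp (logGamma 2 (2 - x / ((2 * Real.pi : ℝ) : ℂ)) -
      logGamma 2 (x / ((2 * Real.pi : ℝ) : ℂ))) := by
  have hx' := fun k : ℕ => hx.neg.add_two_pi.add_two_pi.normalized k
  have e : (2 * ((2 * Real.pi : ℝ) : ℂ) - x) / ((2 * Real.pi : ℝ) : ℂ) =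
      2 - x / ((2 * Real.pi : ℝ) : ℂ) := by
    have := two_pi_ne_zero'
    field_simp
  rw [S2_eq, multipleGamma_eq_exp (fun k => by exact_mod_cast hx.normalized k) (by simp),
    multipleGamma_eq_exp (fun k => ?_) (by simp), e, ← exp_neg, ← exp_add]
  · congr 1
    ring
  · have := hx' k
    rwa [show -x + ((2 * Real.pi : ℝ) : ℂ) + ((2 * Real.pi : ℝ) : ℂ) =
      2 * ((2 * Real.pi : ℝ) : ℂ) - x by ring, Int.cast_natCast] at this

/-- The hypotheses are weaker than `OffLattice` in order to cover `x = 2π`, a lattice point at which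
`S₃` does not vanish and which occurs in `ρ(πi)`. -/
theorem S3_eq_exp {x : ℂ} (hx : ∀ k : ℕ, (k : ℂ) + x / ((2 * Real.pi : ℝ) : ℂ) ≠ 0)
    (hx' : ∀ k : ℕ, (k : ℂ) + (3 - x / ((2 * Real.pi : ℝ) : ℂ)) ≠ 0) :
    S3 (1 / 2) (2 * Real.pi) x =
    exp (-logGamma 3 (3 - x / ((2 * Real.pi : ℝ) : ℂ)) -
      logGamma 3 (x / ((2 * Real.pi : ℝ) : ℂ))) := by
  have e : (3 * ((2 * Real.pi : ℝ) : ℂ) - x) / ((2 * Real.pi : ℝ) : ℂ) =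
      3 - x / ((2 * Real.pi : ℝ) : ℂ) := by
    have := two_pi_ne_zero'
    field_simp
  rw [S3_eq, multipleGamma_eq_exp hx (by simp), multipleGamma_eq_exp (by rwa [e]) (by simp), e,
    ← exp_neg, ← exp_neg, ← exp_add]
  congr 1
  ring

theorem OffLattice.S3_eq_exp {x : ℂ} (hx : OffLattice x) : S3 (1 / 2) (2 * Real.pi) x =
    exp (-logGamma 3 (3 - x / ((2 * Real.pi : ℝ) : ℂ)) -
      logGamma 3 (x / ((2 * Real.pi : ℝ) : ℂ))) :=
  XXZ.S3_eq_exp (fun k => by exact_mod_cast hx.normalized k) fun k h => hx.normalized (-(k + 3)) (by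
    push_cast at h ⊢
    linear_combination -h)

theorem S2_ne_zero {x : ℂ} (hx : OffLattice x) : S2 (1 / 2) (2 * Real.pi) x ≠ 0 := by
  rw [S2_eq_exp hx]
  exact exp_ne_zero _

theorem S3_ne_zero {x : ℂ} (hx : OffLattice x) : S3 (1 / 2) (2 * Real.pi) x ≠ 0 := by
  rw [hx.S3_eq_exp]
  exact exp_ne_zero _

theorem S3_two_pi_ne_zero : S3 (1 / 2) (2 * Real.pi) ((2 * Real.pi : ℝ) : ℂ) ≠ 0 := by
  have h := div_self two_pi_ne_zero'
  rw [S3_eq_exp]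
  · exact exp_ne_zero _
  · intro k
    rw [h]
    exact Nat.cast_add_one_ne_zero k
  · intro k
    rw [h, show (k : ℂ) + (3 - 1) = ((k + 2 : ℕ) : ℂ) by push_cast; ring]
    exact Nat.cast_ne_zero.2 (by omega)

/-- Immediate from the symmetry of the definition under `x ↦ 4π - x`. That argument is written with
two separate shifts to fit `OffLattice.add_two_pi`. -/
theorem S2_mul_reflection {x : ℂ} (hx : OffLattice x) :
    S2 (1 / 2) (2 * Real.pi) x *
      S2 (1 / 2) (2 * Real.pi) (-x + ((2 * Real.pi : ℝ) : ℂ) + ((2 * Real.pi : ℝ) : ℂ)) = 1 := by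
  have h2 := two_pi_ne_zero'
  rw [S2_eq_exp hx, S2_eq_exp hx.neg.add_two_pi.add_two_pi, ← exp_add]
  have e : (-x + ((2 * Real.pi : ℝ) : ℂ) + ((2 * Real.pi : ℝ) : ℂ)) / ((2 * Real.pi : ℝ) : ℂ) =
      2 - x / ((2 * Real.pi : ℝ) : ℂ) := by
    field_simp
    ring
  rw [e, sub_sub_cancel]
  simp

/-- The ladder relation, used at `y` and at `1 - y`, leaves `Γ₁(y) Γ₁(1 - y)`, which the reflection
formula turns into a sine. -/
theorem S2_add_two_pi {x : ℂ} (hx : OffLattice x) :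
    S2 (1 / 2) (2 * Real.pi) (x + ((2 * Real.pi : ℝ) : ℂ)) * (2 * sin (x / 2)) =
      S2 (1 / 2) (2 * Real.pi) x := by
  have h2 := two_pi_ne_zero'
  rw [S2_eq_exp hx, S2_eq_exp hx.add_two_pi]
  have e : (x + ((2 * Real.pi : ℝ) : ℂ)) / ((2 * Real.pi : ℝ) : ℂ) =
      x / ((2 * Real.pi : ℝ) : ℂ) + 1 := by
    field_simp
  have e2 : x / 2 = Real.pi * (x / ((2 * Real.pi : ℝ) : ℂ)) := by
    push_cast
    have : (Real.pi : ℂ) ≠ 0 := ofReal_ne_zero.2 Real.pi_ne_zero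
    field_simp
  have hs := hx.sin_ne_zero
  have hn := hx.normalized
  rw [e2] at hs
  rw [e, e2]
  set y := x / ((2 * Real.pi : ℝ) : ℂ)
  have hr := exp_logGamma_one_reflection hn
  have hn1 : ∀ k : ℕ, (k : ℂ) + y ≠ 0 := fun k => by exact_mod_cast hn k
  have hn2 : ∀ k : ℕ, (k : ℂ) + (1 - y) ≠ 0 := fun k h => hn (-(k + 1)) (by
    push_cast
    linear_combination -h)
  have a1 := logGamma_add_one hn1 (r := 1) (by simp)
  have a2 := logGamma_add_one hn2 (r := 1) (by simp)
  simp only [Nat.reduceAdd] at a1 a2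
  rw [a1, show (2 : ℂ) - (y + 1) = 1 - y by ring, show (2 : ℂ) - y = 1 - y + 1 by ring, a2,
    show logGamma 2 (1 - y) - (logGamma 2 y - logGamma 1 y) =
      (logGamma 2 (1 - y) - logGamma 1 (1 - y) - logGamma 2 y) +
        (logGamma 1 y + logGamma 1 (1 - y)) by ring, exp_add, hr]
  generalize sin (Real.pi * y) = σ at hs
  field_simp

theorem S3_add_two_pi {x : ℂ} (hx : OffLattice x) :
    S3 (1 / 2) (2 * Real.pi) (x + ((2 * Real.pi : ℝ) : ℂ)) * S2 (1 / 2) (2 * Real.pi) x =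
      S3 (1 / 2) (2 * Real.pi) x := by
  have h2 := two_pi_ne_zero'
  rw [hx.S3_eq_exp, hx.add_two_pi.S3_eq_exp, S2_eq_exp hx]
  have e : (x + ((2 * Real.pi : ℝ) : ℂ)) / ((2 * Real.pi : ℝ) : ℂ) =
      x / ((2 * Real.pi : ℝ) : ℂ) + 1 := by
    field_simp
  have hn := hx.normalized
  rw [e]
  set y := x / ((2 * Real.pi : ℝ) : ℂ)
  have hn1 : ∀ k : ℕ, (k : ℂ) + y ≠ 0 := fun k => by exact_mod_cast hn k
  have hn2 : ∀ k : ℕ, (k : ℂ) + (2 - y) ≠ 0 := fun k h => hn (-(k + 2)) (by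
    push_cast
    linear_combination -h)
  have a1 := logGamma_add_one hn1 (r := 2) (by simp)
  have a2 := logGamma_add_one hn2 (r := 2) (by simp)
  simp only [Nat.reduceAdd] at a1 a2
  rw [a1, show (3 : ℂ) - (y + 1) = 2 - y by ring, show (3 : ℂ) - y = 2 - y + 1 by ring, a2,
    ← exp_add]
  congr 1
  ring

/-- One shift takes `π + a` to `3π + a`, the reflection partner of `π - a`. -/
theorem S2_pi_sub_mul {a : ℂ} (ha : OffLattice (Real.pi + a)) :
    S2 (1 / 2) (2 * Real.pi) (Real.pi + a) * S2 (1 / 2) (2 * Real.pi) (Real.pi - a) =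
      2 * cos (a / 2) := by
  have h1 := S2_add_two_pi ha
  have h2 := S2_mul_reflection ha.add_two_pi
  have e : -((Real.pi : ℂ) + a + ((2 * Real.pi : ℝ) : ℂ)) + ((2 * Real.pi : ℝ) : ℂ) +
      ((2 * Real.pi : ℝ) : ℂ) = Real.pi - a := by
    push_cast
    ring
  have e2 : sin ((Real.pi + a) / 2) = cos (a / 2) := by
    rw [← Complex.sin_pi_div_two_sub, ← Complex.sin_pi_sub]
    congr 1
    ring
  rw [e] at h2
  rw [e2] at h1
  rw [← h1]
  linear_combination 2 * cos (a / 2) * h2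

/-- Two shifts take `a` to `4π + a`, the reflection partner of `-a`; the two sine factors differ by
a sign. -/
theorem S2_neg_mul {a : ℂ} (ha : OffLattice a) :
    S2 (1 / 2) (2 * Real.pi) a * S2 (1 / 2) (2 * Real.pi) (-a) = -4 * sin (a / 2) ^ 2 := by
  have h1 := S2_add_two_pi ha
  have h2 := S2_add_two_pi ha.add_two_pi
  have h3 := S2_mul_reflection ha.add_two_pi.add_two_pi
  have e : -(a + ((2 * Real.pi : ℝ) : ℂ) + ((2 * Real.pi : ℝ) : ℂ)) + ((2 * Real.pi : ℝ) : ℂ) +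
      ((2 * Real.pi : ℝ) : ℂ) = -a := by ring
  have e2 : sin ((a + ((2 * Real.pi : ℝ) : ℂ)) / 2) = -sin (a / 2) := by
    rw [← Complex.sin_add_pi]
    congr 1
    push_cast
    ring
  rw [e] at h3
  rw [e2] at h2
  rw [← h1, ← h2]
  linear_combination -4 * sin (a / 2) ^ 2 * h3

theorem offLattice_pi : OffLattice (Real.pi : ℂ) := by
  refine offLattice_of_re 0 ?_ ?_
  · simpa using Real.pi_pos
  · have := Real.pi_pos
    simp only [ofReal_re, Int.cast_zero]
    linarith

theorem S2_pi_sq : S2 (1 / 2) (2 * Real.pi) Real.pi ^ 2 = 2 := by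
  have h := S2_pi_sub_mul (a := 0) (by simpa using offLattice_pi)
  simp only [add_zero, sub_zero, zero_div, Complex.cos_zero, mul_one] at h
  rw [sq, h]

/-! ### The functions `ψ`, `φ`, `ρ` at `ν = 1/2`, `λ = 2π` -/

theorem psi_eq {z : ℂ} (hz : OffLattice (Real.pi + I * z)) :
    psi (1 / 2) (2 * Real.pi) z = sinh z := by
  have hπ : (Real.pi : ℂ) ≠ 0 := ofReal_ne_zero.2 Real.pi_ne_zero
  have e : (Real.pi : ℂ) * z / ((2 * Real.pi : ℝ) : ℂ) = z / 2 := by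
    push_cast
    field_simp
  rw [psi, mul_assoc, S2_pi_sub_mul hz, e, show I * z / 2 = z / 2 * I by ring, Complex.cos_mul_I]
  conv_rhs => rw [show z = 2 * (z / 2) by ring, Complex.sinh_two_mul]
  ring

/-- The four arguments of `S₂` are `± iw` and `π ± iw`. Pairing them across the two factors makes
both product formulas for `S₂` applicable. -/
theorem phi_mul_phi {w : ℂ} (h1 : OffLattice (I * w)) (h2 : OffLattice (Real.pi + I * w)) :
    phi (1 / 2) (2 * Real.pi) (w + Real.pi * I / 2) *
      phi (1 / 2) (2 * Real.pi) (w - Real.pi * I / 2) =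
      1 / (2 * sinh (w / 2) ^ 2 * cosh (w / 2)) := by
  have hA := S2_pi_sub_mul h2
  have hB := S2_neg_mul h1
  rw [show I * w / 2 = w / 2 * I by ring, Complex.cos_mul_I] at hA
  rw [show I * w / 2 = w / 2 * I by ring, Complex.sin_mul_I, mul_pow, I_sq] at hB
  have i2 := I_mul_I
  have e1 : (Real.pi : ℂ) / 2 + I * (w + Real.pi * I / 2) = I * w := by
    linear_combination (Real.pi : ℂ) / 2 * i2
  have e2 : (Real.pi : ℂ) / 2 - I * (w + Real.pi * I / 2) = Real.pi - I * w := by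
    linear_combination -(Real.pi : ℂ) / 2 * i2
  have e3 : (Real.pi : ℂ) / 2 + I * (w - Real.pi * I / 2) = Real.pi + I * w := by
    linear_combination -(Real.pi : ℂ) / 2 * i2
  have e4 : (Real.pi : ℂ) / 2 - I * (w - Real.pi * I / 2) = -(I * w) := by
    linear_combination (Real.pi : ℂ) / 2 * i2
  rw [phi, phi, e1, e2, e3, e4, div_mul_div_comm,
    show ∀ p q r s : ℂ, p * q * (r * s) = (p * s) * (r * q) by intros; ring, hA, hB,
    show (-4 * (sinh (w / 2) ^ 2 * -1) * (2 * cosh (w / 2)) : ℂ) =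
      4 * (2 * sinh (w / 2) ^ 2 * cosh (w / 2)) by ring,
    show (2 * 2 : ℂ) = 4 * 1 by norm_num, mul_div_mul_left _ _ (by norm_num)]

theorem rho_pi_mul_I_ne_zero : rho (1 / 2) (2 * Real.pi) (Real.pi * I) ≠ 0 := by
  have i2 := I_mul_I
  have hπ : (Real.pi : ℂ) ≠ 0 := ofReal_ne_zero.2 Real.pi_ne_zero
  have e0 : (Real.pi : ℂ) * (Real.pi * I) / ((2 * Real.pi : ℝ) : ℂ) = Real.pi / 2 * I := by
    push_cast
    field_simp
  have e1 : (Real.pi : ℂ) - I * (Real.pi * I) = ((2 * Real.pi : ℝ) : ℂ) := by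
    push_cast
    linear_combination -(Real.pi : ℂ) * i2
  have e2 : (Real.pi : ℂ) + ((2 * Real.pi : ℝ) : ℂ) + I * (Real.pi * I) =
      ((2 * Real.pi : ℝ) : ℂ) := by
    linear_combination (Real.pi : ℂ) * i2
  have e3 : -(I * (Real.pi * I)) = (Real.pi : ℂ) := by
    linear_combination -(Real.pi : ℂ) * i2
  have e4 : ((2 * Real.pi : ℝ) : ℂ) + I * (Real.pi * I) = (Real.pi : ℂ) := by
    push_cast
    linear_combination (Real.pi : ℂ) * i2
  rw [rho, e0, e1, e2, e3, e4, Complex.sinh_mul_I, Complex.sin_pi_div_two, one_mul]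
  have h1 := S3_ne_zero offLattice_pi
  have h2 := S3_two_pi_ne_zero
  exact div_ne_zero (mul_ne_zero I_ne_zero (mul_ne_zero h2 h2)) (mul_ne_zero h1 h1)

/-- Shifting by `2π` reduces every `S₃` to one of four values, and these cancel in the product. What
is left is `sinh² cosh²` over four values of `S₂`, whose product is `8 sinh² cosh`. At `b = 0` the
factors themselves are singular. -/
theorem rho_prod {b : ℝ} (hb : b ≠ 0) :
    rho (1 / 2) (2 * Real.pi) b * rho (1 / 2) (2 * Real.pi) (-b) *
      (rho (1 / 2) (2 * Real.pi) (b + Real.pi * I) *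
        rho (1 / 2) (2 * Real.pi) (-b + Real.pi * I)) = cosh (b / 2) / 8 := by
  have i2 := I_mul_I
  have hπ : (Real.pi : ℂ) ≠ 0 := ofReal_ne_zero.2 Real.pi_ne_zero
  have o1 : OffLattice (I * b) := offLattice_of_im_ne_zero (by simpa using hb)
  have o2 : OffLattice (-(I * b)) := o1.neg
  have o3 : OffLattice (Real.pi + I * b) := offLattice_of_im_ne_zero (by simpa using hb)
  have o4 : OffLattice (Real.pi - I * b) := offLattice_of_im_ne_zero (by simpa using hb)
  have f1 := S3_add_two_pi o1
  have f2 := S3_add_two_pi o2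
  have f3 := S3_add_two_pi o3
  have f4 := S3_add_two_pi o4
  have hA := S2_pi_sub_mul o3
  have hB := S2_neg_mul o1
  rw [show I * (b : ℂ) / 2 = b / 2 * I by ring, Complex.cos_mul_I] at hA
  rw [show I * (b : ℂ) / 2 = b / 2 * I by ring, Complex.sin_mul_I, mul_pow, I_sq] at hB
  have n1 := S3_ne_zero o1
  have n2 := S3_ne_zero o2
  have n3 := S3_ne_zero o3
  have n4 := S3_ne_zero o4
  have n7 := S2_ne_zero o1
  have n8 := S2_ne_zero o2
  have n9 := S2_ne_zero o3
  have n10 := S2_ne_zero o4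
  have s0 : ∀ c : ℂ, (Real.pi : ℂ) * c / ((2 * Real.pi : ℝ) : ℂ) = c / 2 := by
    intro c
    push_cast
    field_simp
  have sc : ∀ c : ℂ, sinh ((c + Real.pi * I) / 2) = I * cosh (c / 2) := by
    intro c
    rw [show (c + Real.pi * I) / 2 = c / 2 + Real.pi / 2 * I by ring, Complex.sinh_add,
      Complex.sinh_mul_I, Complex.cosh_mul_I, Complex.sin_pi_div_two, Complex.cos_pi_div_two]
    ring
  have a1 : (Real.pi : ℂ) + ((2 * Real.pi : ℝ) : ℂ) + I * b =
    Real.pi + I * b + ((2 * Real.pi : ℝ) : ℂ) := by ring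
  have a2 : ((2 * Real.pi : ℝ) : ℂ) + I * b = I * b + ((2 * Real.pi : ℝ) : ℂ) := by ring
  have b0 : (Real.pi : ℂ) - I * -b = Real.pi + I * b := by ring
  have b1 : (Real.pi : ℂ) + ((2 * Real.pi : ℝ) : ℂ) + I * -b =
    Real.pi - I * b + ((2 * Real.pi : ℝ) : ℂ) := by ring
  have b2 : ((2 * Real.pi : ℝ) : ℂ) + I * -b = -(I * b) + ((2 * Real.pi : ℝ) : ℂ) := by ring
  have b3 : -(I * -(b : ℂ)) = I * b := by ring
  have c0 : ∀ c : ℂ, (Real.pi : ℂ) - I * (c + Real.pi * I) = -(I * c) + ((2 * Real.pi : ℝ) : ℂ) := by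
    intro c
    push_cast
    linear_combination -(Real.pi : ℂ) * i2
  have c1 : ∀ c : ℂ, (Real.pi : ℂ) + ((2 * Real.pi : ℝ) : ℂ) + I * (c + Real.pi * I) =
      I * c + ((2 * Real.pi : ℝ) : ℂ) := by
    intro c
    linear_combination (Real.pi : ℂ) * i2
  have c2 : ∀ c : ℂ, -(I * (c + Real.pi * I)) = Real.pi - I * c := by
    intro c
    linear_combination -(Real.pi : ℂ) * i2
  have c3 : ∀ c : ℂ, ((2 * Real.pi : ℝ) : ℂ) + I * (c + Real.pi * I) = Real.pi + I * c := by
    intro c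
    push_cast
    linear_combination (Real.pi : ℂ) * i2
  have d1 : -(I * -(b : ℂ)) + ((2 * Real.pi : ℝ) : ℂ) = I * b + ((2 * Real.pi : ℝ) : ℂ) := by ring
  have d2 : I * -(b : ℂ) + ((2 * Real.pi : ℝ) : ℂ) = -(I * b) + ((2 * Real.pi : ℝ) : ℂ) := by ring
  have d3 : (Real.pi : ℂ) + I * -b = Real.pi - I * b := by ring
  simp only [rho, c0, c1, c2, c3, d1, d2, s0, sc]
  simp only [a1, a2, b0, b1, b2, b3, d3]
  have hs : sinh ((b : ℂ) / 2) ≠ 0 := by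
    intro h
    rw [show (b : ℂ) / 2 = ((b / 2 : ℝ) : ℂ) by push_cast; rfl, ← ofReal_sinh, ofReal_eq_zero,
      Real.sinh_eq_zero] at h
    exact hb (by linarith)
  have hc : cosh ((b : ℂ) / 2) ≠ 0 := by
    rw [show (b : ℂ) / 2 = ((b / 2 : ℝ) : ℂ) by push_cast; rfl, ← ofReal_cosh, Ne, ofReal_eq_zero]
    exact (Real.cosh_pos _).ne'
  rw [show -(b : ℂ) / 2 = -(b / 2) by ring, Complex.sinh_neg, Complex.cosh_neg]
  rw [← eq_div_iff n7] at f1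
  rw [← eq_div_iff n8] at f2
  rw [← eq_div_iff n9] at f3
  rw [← eq_div_iff n10] at f4
  rw [f1, f2, f3, f4]
  generalize S3 (1 / 2) (2 * Real.pi) (I * b) = t1 at *
  generalize S3 (1 / 2) (2 * Real.pi) (-(I * b)) = t2 at *
  generalize S3 (1 / 2) (2 * Real.pi) (Real.pi + I * b) = t3 at *
  generalize S3 (1 / 2) (2 * Real.pi) (Real.pi - I * b) = t4 at *
  generalize S2 (1 / 2) (2 * Real.pi) (I * b) = u1 at *
  generalize S2 (1 / 2) (2 * Real.pi) (-(I * b)) = u2 at *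
  generalize S2 (1 / 2) (2 * Real.pi) (Real.pi + I * b) = u3 at *
  generalize S2 (1 / 2) (2 * Real.pi) (Real.pi - I * b) = u4 at *
  generalize sinh ((b : ℂ) / 2) = sh at *
  generalize cosh ((b : ℂ) / 2) = ch at *
  have key : u1 * u2 * (u3 * u4) = 8 * sh ^ 2 * ch := by
    rw [hA, hB]
    ring
  field_simp
  linear_combination (-8 * sh ^ 2 * ch) * i2 - key

/-! ### The one-dimensional integrals -/

theorem exp_abs_le_two_mul_cosh (x : ℝ) : Real.exp |x| ≤ 2 * Real.cosh x := by
  rw [← Real.cosh_abs, Real.cosh_eq]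
  linarith [Real.exp_pos (-|x|)]

theorem mul_exp_abs_le_norm_two_mul_cosh {m x y : ℝ} (hm : m ≤ |Real.cos y|) :
    m * Real.exp |x| ≤ ‖2 * cosh ((x : ℂ) + y * I)‖ := by
  have hre : (cosh ((x : ℂ) + y * I)).re = Real.cosh x * Real.cos y := by
    rw [Complex.cosh_add, Complex.cosh_mul_I, Complex.sinh_mul_I, ← ofReal_cosh, ← ofReal_cos,
      ← ofReal_sinh, ← ofReal_sin, ← ofReal_mul, ← mul_assoc, ← ofReal_mul]
    rw [add_re, ofReal_re, re_ofReal_mul, I_re, mul_zero, add_zero]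
  have h := Complex.abs_re_le_norm (cosh ((x : ℂ) + y * I))
  rw [hre, abs_mul, abs_of_pos (Real.cosh_pos x)] at h
  rw [norm_mul, Complex.norm_ofNat]
  calc m * Real.exp |x| ≤ |Real.cos y| * (2 * Real.cosh x) :=
        mul_le_mul hm (exp_abs_le_two_mul_cosh x) (Real.exp_pos _).le (abs_nonneg _)
    _ ≤ _ := by linarith

theorem mul_exp_abs_le_norm_two_mul_sinh {m x y : ℝ} (hm : m ≤ |Real.sin y|) :
    m * Real.exp |x| ≤ ‖2 * sinh ((x : ℂ) + y * I)‖ := by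
  have him : (sinh ((x : ℂ) + y * I)).im = Real.cosh x * Real.sin y := by
    rw [Complex.sinh_add, Complex.cosh_mul_I, Complex.sinh_mul_I, ← ofReal_cosh, ← ofReal_cos,
      ← ofReal_sinh, ← ofReal_sin, ← ofReal_mul, ← mul_assoc, ← ofReal_mul]
    rw [add_im, ofReal_im, im_ofReal_mul, I_im, mul_one, zero_add]
  have h := Complex.abs_im_le_norm (sinh ((x : ℂ) + y * I))
  rw [him, abs_mul, abs_of_pos (Real.cosh_pos x)] at h
  rw [norm_mul, Complex.norm_ofNat]
  calc m * Real.exp |x| ≤ |Real.sin y| * (2 * Real.cosh x) :=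
        mul_le_mul hm (exp_abs_le_two_mul_cosh x) (Real.exp_pos _).le (abs_nonneg _)
    _ ≤ _ := by linarith

theorem norm_one_div_le_of_le {m R t b : ℝ} {z : ℂ} (hm : 0 < m) (hb : |b| ≤ R)
    (h : m * Real.exp |(t - b) / 2| ≤ ‖z‖) :
    ‖1 / z‖ ≤ Real.exp (R / 2) / m * Real.exp (-|t| / 2) := by
  have h1 : |t| / 2 - R / 2 ≤ |(t - b) / 2| := by
    rw [abs_div, abs_two]
    linarith [abs_sub_abs_le_abs_sub t b]
  have h2 : m * Real.exp (|t| / 2 - R / 2) ≤ ‖z‖ :=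
    (mul_le_mul_of_nonneg_left (Real.exp_le_exp.2 h1) hm.le).trans h
  have h3 : 0 < m * Real.exp (|t| / 2 - R / 2) := by positivity
  rw [norm_div, norm_one]
  refine (one_div_le_one_div_of_le h3 h2).trans (le_of_eq ?_)
  rw [div_mul_eq_mul_div, ← Real.exp_add, one_div, mul_inv, ← Real.exp_neg, div_eq_mul_inv,
    mul_comm]
  congr 2
  ring

theorem half_shift_eq (t b η : ℝ) :
    ((t : ℂ) + η * I - b) / 2 = (((t - b) / 2 : ℝ) : ℂ) + ((η / 2 : ℝ) : ℂ) * I := by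
  push_cast
  ring

theorem card_Iic_add_card_Ici {n : ℕ} (l : Fin n) :
    (Finset.Iic l).card + (Finset.Ici l).card = n + 1 := by
  rw [Fin.card_Iic, Fin.card_Ici]
  omega

/-- The site `l` occurs in both products, so there are `n + 1` denominators, each growing like
`e^{|t|/2}`; the exponential grows at most like `e^{(n-1)|t|/2}`. The constant depends on `β` and
`η` only through `R` and `m`, as needed for contour shifts and dominated convergence. -/
theorem norm_integrandI_le {n : ℕ} {β : Fin n → ℝ} (k l : Fin n) {R m η : ℝ} (t : ℝ)
    (hR : ∀ j, |β j| ≤ R) (hm : 0 < m) (hs : m ≤ |Real.sin (η / 2)|)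
    (hc : m ≤ |Real.cos (η / 2)|) :
    ‖integrandI β k l ((t : ℂ) + (η : ℂ) * I)‖ ≤
      (Real.exp (R / 2) / m) ^ (n + 1) * Real.exp (-|t|) := by
  set D := Real.exp (R / 2) / m * Real.exp (-|t| / 2) with hD
  have hD0 : 0 ≤ D := by positivity
  have hcosh : ∀ j, ‖1 / (2 * cosh (((t : ℂ) + (η : ℂ) * I - β j) / 2))‖ ≤ D := fun j => by
    rw [half_shift_eq]
    exact norm_one_div_le_of_le hm (hR j) (mul_exp_abs_le_norm_two_mul_cosh hc)
  have hsinh : ∀ j, ‖1 / (2 * sinh (((t : ℂ) + (η : ℂ) * I - β j) / 2))‖ ≤ D := fun j => by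
    rw [half_shift_eq]
    exact norm_one_div_le_of_le hm (hR j) (mul_exp_abs_le_norm_two_mul_sinh hs)
  have hpi : ‖(1 / (2 * Real.pi) : ℂ)‖ ≤ 1 := by
    rw [norm_div, norm_one, norm_mul, Complex.norm_ofNat, norm_real, Real.norm_of_nonneg
      Real.pi_pos.le, div_le_one (by positivity)]
    linarith [Real.pi_gt_three]
  have hk : (((k : ℕ) : ℝ) + 1) ≤ n := by exact_mod_cast k.2
  have hexp : ‖exp ((((k : ℕ) : ℂ) + 1 - ((n : ℂ) + 1) / 2) * ((t : ℂ) + (η : ℂ) * I))‖ ≤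
      Real.exp (((n : ℝ) - 1) / 2 * |t|) := by
    rw [Complex.norm_exp]
    refine Real.exp_le_exp.2 ?_
    have e : ((((k : ℕ) : ℂ) + 1 - ((n : ℂ) + 1) / 2) * ((t : ℂ) + (η : ℂ) * I)) =
        ((((k : ℕ) : ℝ) + 1 - ((n : ℝ) + 1) / 2 : ℝ) : ℂ) * ((t : ℂ) + (η : ℂ) * I) := by
      push_cast
      rfl
    rw [e, re_ofReal_mul]
    simp only [add_re, ofReal_re, mul_re, I_re, mul_zero, ofReal_im, I_im, mul_one, sub_self,
      add_zero]
    refine (le_abs_self _).trans ?_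
    rw [abs_mul]
    refine mul_le_mul_of_nonneg_right (abs_le.2 ⟨?_, ?_⟩) (abs_nonneg t)
    · linarith [((k : ℕ).cast_nonneg : (0 : ℝ) ≤ ((k : ℕ) : ℝ))]
    · linarith
  rw [integrandI, norm_mul, norm_mul, norm_mul, norm_prod, norm_prod]
  have h1 : ∏ j ∈ Finset.Iic l, ‖1 / (2 * cosh (((t : ℂ) + (η : ℂ) * I - β j) / 2))‖ ≤
      D ^ (Finset.Iic l).card :=
    (Finset.prod_le_prod (fun _ _ => norm_nonneg _) fun j _ => hcosh j).trans_eq (Finset.prod_const D)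
  have h2 : ∏ j ∈ Finset.Ici l, ‖1 / (2 * sinh (((t : ℂ) + (η : ℂ) * I - β j) / 2))‖ ≤
      D ^ (Finset.Ici l).card :=
    (Finset.prod_le_prod (fun _ _ => norm_nonneg _) fun j _ => hsinh j).trans_eq (Finset.prod_const D)
  calc _ ≤ 1 * Real.exp (((n : ℝ) - 1) / 2 * |t|) * D ^ (Finset.Iic l).card *
        D ^ (Finset.Ici l).card := by gcongr
    _ = Real.exp (((n : ℝ) - 1) / 2 * |t|) * D ^ (n + 1) := by
        rw [one_mul, mul_assoc, ← pow_add, card_Iic_add_card_Ici]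
    _ = (Real.exp (R / 2) / m) ^ (n + 1) *
        (Real.exp (((n : ℝ) - 1) / 2 * |t|) * Real.exp (-|t| / 2) ^ (n + 1)) := by
        rw [hD, mul_pow]
        ring
    _ = _ := by
        rw [← Real.exp_nat_mul, ← Real.exp_add]
        congr 2
        push_cast
        ring

theorem integrable_exp_neg_abs : Integrable fun t : ℝ => Real.exp (-|t|) := by
  refine Integrable.mono' (integrable_inv_one_add_sq.const_mul 2)
    (by fun_prop) (Eventually.of_forall fun t => ?_)
  rw [Real.norm_of_nonneg (Real.exp_pos _).le, Real.exp_neg, ← div_eq_mul_inv, inv_eq_one_div,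
    div_le_div_iff₀ (Real.exp_pos _) (by positivity)]
  have h := Real.quadratic_le_exp_of_nonneg (abs_nonneg t)
  rw [sq_abs] at h
  linarith [abs_nonneg t]

theorem measurable_integrandI_line {n : ℕ} (β : Fin n → ℝ) (k l : Fin n) (η : ℝ) :
    Measurable fun t : ℝ => integrandI β k l ((t : ℂ) + (η : ℂ) * I) := by
  unfold integrandI
  fun_prop

theorem exists_lower_bound_of_strip {η : ℝ} (h0 : η ≠ 0) (hπ : |η| < Real.pi) :
    ∃ m : ℝ, 0 < m ∧ m ≤ |Real.sin (η / 2)| ∧ m ≤ |Real.cos (η / 2)| := by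
  obtain ⟨h1, h2⟩ := abs_lt.1 hπ
  have hc : 0 < Real.cos (η / 2) := Real.cos_pos_of_mem_Ioo ⟨by linarith, by linarith⟩
  have hs : Real.sin (η / 2) ≠ 0 := by
    intro h
    rw [Real.sin_eq_zero_iff_of_lt_of_lt (by linarith) (by linarith)] at h
    exact h0 (by linarith)
  exact ⟨min |Real.sin (η / 2)| |Real.cos (η / 2)|,
    lt_min (abs_pos.2 hs) (abs_pos.2 hc.ne'), min_le_left _ _, min_le_right _ _⟩

theorem integrable_integrandI {n : ℕ} (β : Fin n → ℝ) (k l : Fin n) {η : ℝ} (h0 : η ≠ 0)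
    (hπ : |η| < Real.pi) :
    Integrable fun t : ℝ => integrandI β k l ((t : ℂ) + (η : ℂ) * I) := by
  obtain ⟨m, hm, hs, hc⟩ := exists_lower_bound_of_strip h0 hπ
  exact Integrable.mono' (integrable_exp_neg_abs.const_mul _)
    (measurable_integrandI_line β k l η).aestronglyMeasurable
    (Eventually.of_forall fun t => norm_integrandI_le (R := ‖β‖) k l t
      (fun j => norm_le_pi_norm β j) hm hs hc)

theorem two_mul_cosh_sub_ne_zero {m : ℝ} (hm : 0 < m) {η : ℝ} (t b : ℝ)
    (hc : m ≤ |Real.cos (η / 2)|) : 2 * cosh (((t : ℂ) + η * I - b) / 2) ≠ 0 := by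
  rw [half_shift_eq, ← norm_pos_iff]
  exact lt_of_lt_of_le (by positivity) (mul_exp_abs_le_norm_two_mul_cosh hc)

theorem two_mul_sinh_sub_ne_zero {m : ℝ} (hm : 0 < m) {η : ℝ} (t b : ℝ)
    (hs : m ≤ |Real.sin (η / 2)|) : 2 * sinh (((t : ℂ) + η * I - b) / 2) ≠ 0 := by
  rw [half_shift_eq, ← norm_pos_iff]
  exact lt_of_lt_of_le (by positivity) (mul_exp_abs_le_norm_two_mul_sinh hs)

theorem differentiableAt_integrandI {n : ℕ} (β : Fin n → ℝ) (k l : Fin n) {z : ℂ}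
    (h0 : z.im ≠ 0) (hπ : |z.im| < Real.pi) : DifferentiableAt ℂ (integrandI β k l) z := by
  obtain ⟨m, hm, hs, hc⟩ := exists_lower_bound_of_strip h0 hπ
  have hz : z = (z.re : ℂ) + z.im * I := (re_add_im z).symm
  have hcosh : ∀ j, 2 * cosh ((z - β j) / 2) ≠ 0 := fun j => by
    rw [hz]
    exact two_mul_cosh_sub_ne_zero hm _ _ hc
  have hsinh : ∀ j, 2 * sinh ((z - β j) / 2) ≠ 0 := fun j => by
    rw [hz]
    exact two_mul_sinh_sub_ne_zero hm _ _ hs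
  unfold integrandI
  refine DifferentiableAt.mul (DifferentiableAt.mul (by fun_prop) ?_) ?_
  · exact DifferentiableAt.fun_finsetProd fun j _ => DifferentiableAt.div (by fun_prop)
      (by fun_prop) (hcosh j)
  · exact DifferentiableAt.fun_finsetProd fun j _ => DifferentiableAt.div (by fun_prop)
      (by fun_prop) (hsinh j)

/-! ### Contour shift, conjugation and continuity in the parameters -/

theorem tendsto_const_mul_exp_neg_abs (C : ℝ) :
    Tendsto (fun T : ℝ => C * Real.exp (-|T|)) atTop (𝓝 0) := by
  have h : Tendsto (fun T : ℝ => C * Real.exp (-T)) atTop (𝓝 (C * 0)) :=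
    (Real.tendsto_exp_neg_atTop_nhds_zero).const_mul C
  rw [mul_zero] at h
  refine h.congr' ?_
  filter_upwards [eventually_ge_atTop 0] with T hT
  rw [abs_of_nonneg hT]

theorem integral_integrandI_eq_of_lt {n : ℕ} (β : Fin n → ℝ) (k l : Fin n) {η₁ η₂ : ℝ}
    (h1 : 0 < η₁) (h12 : η₁ < η₂) (h2 : η₂ < Real.pi) :
    ∫ t : ℝ, integrandI β k l ((t : ℂ) + (η₁ : ℂ) * I) =
      ∫ t : ℝ, integrandI β k l ((t : ℂ) + (η₂ : ℂ) * I) := by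
  set f := integrandI β k l with hf
  have habs : ∀ y ∈ Icc η₁ η₂, y ≠ 0 ∧ |y| < Real.pi := fun y hy => by
    have h0 : 0 < y := h1.trans_le hy.1
    exact ⟨h0.ne', by rw [abs_of_pos h0]; linarith [hy.2]⟩
  have i1 := integrable_integrandI β k l (habs η₁ ⟨le_rfl, h12.le⟩).1 (habs η₁ ⟨le_rfl, h12.le⟩).2
  have i2 := integrable_integrandI β k l (habs η₂ ⟨h12.le, le_rfl⟩).1 (habs η₂ ⟨h12.le, le_rfl⟩).2
  have t1 := intervalIntegral_tendsto_integral i1 tendsto_neg_atTop_atBot tendsto_id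
  have t2 := intervalIntegral_tendsto_integral i2 tendsto_neg_atTop_atBot tendsto_id
  -- For heights in `[η₁, η₂]` the sine of the half height is smallest at the lower end and the
  -- cosine at the upper end, so this `m` serves the whole rectangle.
  set m := min (Real.sin (η₁ / 2)) (Real.cos (η₂ / 2)) with hm
  have hm0 : 0 < m := lt_min (Real.sin_pos_of_pos_of_lt_pi (by linarith) (by linarith))
    (Real.cos_pos_of_mem_Ioo ⟨by linarith, by linarith⟩)
  obtain ⟨C, hC⟩ : ∃ C : ℝ, ∀ (T : ℝ) (y : ℝ), y ∈ Icc η₁ η₂ →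
      ‖f ((T : ℂ) + (y : ℂ) * I)‖ ≤ C * Real.exp (-|T|) := by
    refine ⟨_, fun T y hy => norm_integrandI_le (R := ‖β‖) k l T
      (fun j => norm_le_pi_norm β j) hm0 ?_ ?_⟩
    · refine (min_le_left _ _).trans (le_trans ?_ (le_abs_self _))
      exact Real.sin_le_sin_of_le_of_le_pi_div_two (by linarith) (by linarith [hy.2])
        (by linarith [hy.1])
    · refine (min_le_right _ _).trans (le_trans ?_ (le_abs_self _))
      exact Real.cos_le_cos_of_nonneg_of_le_pi (by linarith [hy.1]) (by linarith)
        (by linarith [hy.2])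
  have hvert : ∀ T : ℝ, ‖∫ y : ℝ in η₁..η₂, f ((T : ℂ) + (y : ℂ) * I)‖ ≤
      C * Real.exp (-|T|) * |η₂ - η₁| := fun T => by
    refine intervalIntegral.norm_integral_le_of_norm_le_const fun y hy => hC T y ?_
    rw [uIoc_of_le h12.le] at hy
    exact ⟨hy.1.le, hy.2⟩
  have hlim : Tendsto (fun T : ℝ => C * Real.exp (-|T|) * |η₂ - η₁|) atTop (𝓝 0) := by
    simpa using (tendsto_const_mul_exp_neg_abs C).mul_const |η₂ - η₁|
  have v1 : Tendsto (fun T : ℝ => ∫ y : ℝ in η₁..η₂, f ((T : ℂ) + (y : ℂ) * I)) atTop (𝓝 0) :=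
    squeeze_zero_norm hvert hlim
  have v2 : Tendsto (fun T : ℝ => ∫ y : ℝ in η₁..η₂, f (((-T : ℝ) : ℂ) + (y : ℂ) * I)) atTop
      (𝓝 0) := squeeze_zero_norm (fun T => by simpa using hvert (-T)) hlim
  have hrect : ∀ T : ℝ, (∫ x : ℝ in -T..T, f (x + η₁ * I)) - (∫ x : ℝ in -T..T, f (x + η₂ * I)) +
      I • (∫ y : ℝ in η₁..η₂, f ((T : ℂ) + y * I)) -
      I • (∫ y : ℝ in η₁..η₂, f (((-T : ℝ) : ℂ) + y * I)) = 0 := fun T => by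
    have := integral_boundary_rect_eq_zero_of_differentiableOn f (⟨-T, η₁⟩ : ℂ) ⟨T, η₂⟩
      (fun z hz => by
        obtain ⟨-, hz2⟩ := mem_reProdIm.1 hz
        rw [uIcc_of_le h12.le] at hz2
        exact (differentiableAt_integrandI β k l (habs _ hz2).1
          (habs _ hz2).2).differentiableWithinAt)
    exact this
  have hall := ((t1.sub t2).add (v1.const_smul I)).sub (v2.const_smul I)
  have hz := tendsto_nhds_unique (hall.congr fun T => hrect T) tendsto_const_nhds
  simp only [smul_zero, add_zero, sub_zero] at hz
  exact sub_eq_zero.1 hz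

theorem integral_integrandI_eq {n : ℕ} (β : Fin n → ℝ) (k l : Fin n) {η₁ η₂ : ℝ}
    (h1 : 0 < η₁) (h1' : η₁ < Real.pi) (h2 : 0 < η₂) (h2' : η₂ < Real.pi) :
    ∫ t : ℝ, integrandI β k l ((t : ℂ) + (η₁ : ℂ) * I) =
      ∫ t : ℝ, integrandI β k l ((t : ℂ) + (η₂ : ℂ) * I) := by
  rcases lt_trichotomy η₁ η₂ with h | h | h
  · exact integral_integrandI_eq_of_lt β k l h1 h h2'
  · rw [h]
  · exact (integral_integrandI_eq_of_lt β k l h2 h h1').symm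

theorem conj_integrandI {n : ℕ} (β : Fin n → ℝ) (k l : Fin n) (z : ℂ) :
    conj (integrandI β k l z) = integrandI β k l (conj z) := by
  simp [integrandI, map_prod, map_ofNat (starRingEnd ℂ) 2, ← Complex.exp_conj, ← Complex.cosh_conj, ← Complex.sinh_conj]

/-- The integrand is real on the real axis, so conjugation reflects the line. This produces the
conjugate entries for the last `n` positions. -/
theorem conj_integral_integrandI {n : ℕ} (β : Fin n → ℝ) (k l : Fin n) (η : ℝ) :
    conj (∫ t : ℝ, integrandI β k l ((t : ℂ) + (η : ℂ) * I)) =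
      ∫ t : ℝ, integrandI β k l ((t : ℂ) + ((-η : ℝ) : ℂ) * I) := by
  rw [← integral_conj]
  congr 1
  funext t
  rw [conj_integrandI]
  simp

theorem continuous_entryI {n : ℕ} {η : ℝ} (h0 : 0 < η) (hπ : η < Real.pi) (k l : Fin n) :
    Continuous fun β : Fin n → ℝ => entryI β η k l := by
  obtain ⟨m, hm, hs, hc⟩ := exists_lower_bound_of_strip h0.ne' (by rwa [abs_of_pos h0])
  unfold entryI
  refine continuous_const.mul (continuous_iff_continuousAt.2 fun β => ?_)
  refine continuousAt_of_dominated
    (bound := fun t => (Real.exp ((‖β‖ + 1) / 2) / m) ^ (n + 1) * Real.exp (-|t|))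
    (Eventually.of_forall fun β' => (measurable_integrandI_line β' k l η).aestronglyMeasurable)
    ?_ (integrable_exp_neg_abs.const_mul _) (Eventually.of_forall fun t => ?_)
  · filter_upwards [Metric.ball_mem_nhds β one_pos] with β' hβ'
    refine Eventually.of_forall fun t => norm_integrandI_le k l t (fun j => ?_) hm hs hc
    refine (norm_le_pi_norm β' j).trans ?_
    have := norm_sub_norm_le β' β
    rw [mem_ball_iff_norm] at hβ'
    linarith
  · refine Continuous.continuousAt ?_
    unfold integrandI
    refine Continuous.mul (Continuous.mul (by fun_prop) ?_) ?_
    · exact continuous_finsetProd _ fun j _ => Continuous.div (by fun_prop) (by fun_prop)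
        fun β' => two_mul_cosh_sub_ne_zero hm t (β' j) hc
    · exact continuous_finsetProd _ fun j _ => Continuous.div (by fun_prop) (by fun_prop)
        fun β' => two_mul_sinh_sub_ne_zero hm t (β' j) hs

theorem continuous_determinantFormula {n : ℕ} (ε : Fin (n + n) → Bool)
    (hε : (plusSet ε).card = n) {η : ℝ} (h0 : 0 < η) (hπ : η < Real.pi) :
    Continuous fun β : Fin n → ℝ => determinantFormula ε hε η β := by
  have hent : ∀ (k : Fin n) (p : Fin (n + n)),
      Continuous fun β : Fin n → ℝ => entryIExt β η k p := by
    intro k p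
    unfold entryIExt
    refine Fin.addCases (fun l => ?_) (fun q => ?_) p
    · simp only [Fin.append_left]
      exact continuous_entryI h0 hπ k l
    · simp only [Fin.append_right]
      exact Complex.continuous_conj.comp (continuous_entryI h0 hπ k q.rev)
  unfold determinantFormula
  refine Continuous.mul (by fun_prop) (Continuous.matrix_det ?_)
  exact continuous_matrix fun k k' => hent k _

/-! ### Finite products -/

section Products

variable {M : Type*} [CommMonoid M] {n : ℕ}

theorem prod_Ioi_eq_prod_ite (p : Fin n) (f : Fin n → M) :
    ∏ j ∈ Finset.Ioi p, f j = ∏ j, if p < j then f j else 1 := by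
  rw [← Finset.prod_filter]
  congr 1
  ext
  simp

theorem prod_Iio_eq_prod_ite (p : Fin n) (f : Fin n → M) :
    ∏ j ∈ Finset.Iio p, f j = ∏ j, if j < p then f j else 1 := by
  rw [← Finset.prod_filter]
  congr 1
  ext
  simp

theorem prod_Ici_eq_prod_ite (p : Fin n) (f : Fin n → M) :
    ∏ j ∈ Finset.Ici p, f j = ∏ j, if p ≤ j then f j else 1 := by
  rw [← Finset.prod_filter]
  congr 1
  ext
  simp

theorem prod_Iic_eq_prod_ite (p : Fin n) (f : Fin n → M) :
    ∏ j ∈ Finset.Iic p, f j = ∏ j, if j ≤ p then f j else 1 := by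
  rw [← Finset.prod_filter]
  congr 1
  ext
  simp

theorem prod_rev (f : Fin n → M) : ∏ j : Fin n, f j.rev = ∏ j, f j :=
  Equiv.prod_comp Fin.revPerm f

theorem prod_lt_eq_gt (l : Fin n) (a b c : M) :
    (∏ j : Fin n, if j < l then a else if j = l then b else c) =
      a ^ (l : ℕ) * b * c ^ (n - 1 - (l : ℕ)) := by
  have h : ∀ j : Fin n, (if j < l then a else if j = l then b else c) =
      (if j < l then a else 1) * (if j = l then b else 1) * (if l < j then c else 1) := by
    intro j
    rcases lt_trichotomy j l with h | h | h
    · simp [h, h.ne, h.not_gt]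
    · simp [h]
    · simp [h, h.ne', h.not_gt]
  rw [Finset.prod_congr rfl fun j _ => h j, Finset.prod_mul_distrib, Finset.prod_mul_distrib,
    ← prod_Iio_eq_prod_ite, ← prod_Ioi_eq_prod_ite, Finset.prod_const, Finset.prod_const,
    Fin.card_Iio, Fin.card_Ioi, Finset.prod_ite_eq' Finset.univ l fun _ => b]
  simp

theorem prod_Ioi_const (c : M) :
    (∏ j : Fin n, ∏ _k ∈ Finset.Ioi j, c) = c ^ (n * (n - 1) / 2) := by
  simp_rw [Finset.prod_const, Fin.card_Ioi]
  rw [Finset.prod_pow_eq_pow_sum]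
  congr 1
  rw [Fin.sum_univ_eq_sum_range fun i => n - 1 - i, Finset.sum_range_reflect fun i => i,
    Finset.sum_range_id]

theorem prod_Ioi_mul (g : Fin n → M) :
    ∏ i, ∏ j ∈ Finset.Ioi i, (g i * g j) = ∏ i, g i ^ (n - 1) := by
  rw [Finset.prod_prod_Ioi_mul_eq_prod_prod_off_diag fun _ i => g i]
  simp [Finset.card_compl]

theorem prod_prod_eq_diag_mul (f : Fin n → Fin n → M) :
    ∏ i, ∏ j, f i j = (∏ i, f i i) * ∏ i, ∏ j ∈ Finset.Ioi i, (f i j * f j i) := by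
  rw [Finset.prod_prod_Ioi_mul_eq_prod_prod_off_diag fun j i => f i j, ← Finset.prod_mul_distrib]
  refine Finset.prod_congr rfl fun i _ => ?_
  rw [← Finset.mul_prod_erase _ _ (Finset.mem_univ i), Finset.compl_singleton]

theorem prod_Ioi_rev (f : Fin n → Fin n → M) :
    ∏ i : Fin n, ∏ j ∈ Finset.Ioi i, f i.rev j.rev = ∏ i, ∏ j ∈ Finset.Ioi i, f j i := by
  simp_rw [prod_Ioi_eq_prod_ite]
  rw [← prod_rev]
  simp_rw [Fin.rev_rev]
  have h : ∀ i : Fin n, (∏ j : Fin n, if i.rev < j then f i j.rev else 1) =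
      ∏ j : Fin n, if j < i then f i j else 1 := fun i => by
    rw [← prod_rev]
    simp [Fin.rev_lt_rev]
  rw [Finset.prod_congr rfl fun i _ => h i, Finset.prod_comm]

theorem prod_Ioi_add (F : Fin (n + n) → Fin (n + n) → M) :
    ∏ p, ∏ q ∈ Finset.Ioi p, F p q =
      (∏ i, ∏ j ∈ Finset.Ioi i, F (Fin.castAdd n i) (Fin.castAdd n j)) *
        (∏ i, ∏ j, F (Fin.castAdd n i) (Fin.natAdd n j)) *
        ∏ i, ∏ j ∈ Finset.Ioi i, F (Fin.natAdd n i) (Fin.natAdd n j) := by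
  have h1 : ∀ i j : Fin n, Fin.castAdd n i < Fin.castAdd n j ↔ i < j := fun i j => Iff.rfl
  have h2 : ∀ i j : Fin n, Fin.castAdd n i < Fin.natAdd n j := fun i j => by
    simp only [Fin.lt_def, Fin.val_castAdd, Fin.val_natAdd]
    omega
  have h3 : ∀ i j : Fin n, Fin.natAdd n i < Fin.natAdd n j ↔ i < j := fun i j => by
    rw [Fin.lt_def, Fin.lt_def, Fin.val_natAdd, Fin.val_natAdd, Nat.add_lt_add_iff_left]
  have h4 : ∀ i j : Fin n, ¬ Fin.natAdd n i < Fin.castAdd n j := fun i j => (h2 j i).not_gt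
  simp_rw [prod_Ioi_eq_prod_ite, Fin.prod_univ_add, h1, h2, h3, h4, if_true, if_false,
    Finset.prod_mul_distrib, Finset.prod_const_one, one_mul]

end Products

/-! ### The prefactor -/

theorem corrParams_castAdd {n : ℕ} (β : Fin n → ℝ) (j : Fin n) :
    corrParams β (Fin.castAdd n j) = β j + Real.pi * I := by
  simp only [corrParams, Fin.append_left]

theorem corrParams_natAdd {n : ℕ} (β : Fin n → ℝ) (j : Fin n) :
    corrParams β (Fin.natAdd n j) = β j.rev := by
  simp only [corrParams, Fin.append_right]

/-- The pairs of positions form three blocks. The diagonal of the mixed block gives `ρ(πi)^n`,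
cancelled by `c_n` since `π S₂(π)² / λ = 1`. Every pair of sites then collects the four factors of
`rho_prod`, and `-16 · (1/8) = -2`. -/
theorem prefactor_eq {n : ℕ} {β : Fin n → ℝ} (hβ : Function.Injective β) :
    cConst (1 / 2) (2 * Real.pi) n *
      (∏ j, ∏ k ∈ Finset.Ioi j,
        rho (1 / 2) (2 * Real.pi) (corrParams β j - corrParams β k)) =
      ∏ j : Fin n, ∏ k ∈ Finset.Ioi j, -2 * cosh (((β j : ℂ) - β k) / 2) := by
  have hπ : (Real.pi : ℂ) ≠ 0 := ofReal_ne_zero.2 Real.pi_ne_zero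
  set ρ := rho (1 / 2) (2 * Real.pi) with hρ
  have hρ0 : ρ (Real.pi * I) ≠ 0 := rho_pi_mul_I_ne_zero
  have hc : cConst (1 / 2) (2 * Real.pi) n =
      (∏ j : Fin n, ∏ _k ∈ Finset.Ioi j, (-16 : ℂ)) * ∏ _j : Fin n, (ρ (Real.pi * I))⁻¹ := by
    rw [cConst, S2_pi_sq, ← hρ, prod_Ioi_const, Finset.prod_const, Finset.card_univ,
      Fintype.card_fin]
    congr 2
    push_cast
    field_simp
  have e1 : ∀ i j : Fin n, corrParams β (Fin.castAdd n i) - corrParams β (Fin.castAdd n j) =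
      β i - β j := fun i j => by
    rw [corrParams_castAdd, corrParams_castAdd]
    ring
  have e2 : ∀ i j : Fin n, corrParams β (Fin.castAdd n i) - corrParams β (Fin.natAdd n j) =
      β i - β j.rev + Real.pi * I := fun i j => by
    rw [corrParams_castAdd, corrParams_natAdd]
    ring
  have e3 : ∀ i j : Fin n, corrParams β (Fin.natAdd n i) - corrParams β (Fin.natAdd n j) =
      β i.rev - β j.rev := fun i j => by
    rw [corrParams_natAdd, corrParams_natAdd]
  rw [hc, prod_Ioi_add]
  simp_rw [e1, e2, e3]
  rw [prod_Ioi_rev fun i j => ρ (β i - β j)]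
  have hmid : ∏ i : Fin n, ∏ j : Fin n, ρ (β i - β j.rev + Real.pi * I) =
      ∏ i : Fin n, ∏ j : Fin n, ρ (β i - β j + Real.pi * I) :=
    Finset.prod_congr rfl fun i _ => prod_rev fun j => ρ (β i - β j + Real.pi * I)
  rw [hmid, prod_prod_eq_diag_mul]
  have hdiag : (∏ _j : Fin n, (ρ (Real.pi * I))⁻¹) * ∏ i : Fin n, ρ (β i - β i + Real.pi * I) = 1 := by
    rw [← Finset.prod_mul_distrib]
    refine Finset.prod_eq_one fun i _ => ?_
    rw [sub_self, zero_add, inv_mul_cancel₀ hρ0]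
  have hpair : ∏ j : Fin n, ∏ k ∈ Finset.Ioi j, -2 * cosh (((β j : ℂ) - β k) / 2) =
      (∏ j : Fin n, ∏ _k ∈ Finset.Ioi j, (-16 : ℂ)) *
        ((∏ i : Fin n, ∏ j ∈ Finset.Ioi i, ρ (β i - β j)) *
          (∏ i : Fin n, ∏ j ∈ Finset.Ioi i,
            (ρ (β i - β j + Real.pi * I) * ρ (β j - β i + Real.pi * I))) *
          ∏ i : Fin n, ∏ j ∈ Finset.Ioi i, ρ (β j - β i)) := by
    simp_rw [← Finset.prod_mul_distrib]
    refine Finset.prod_congr rfl fun i _ => Finset.prod_congr rfl fun j hj => ?_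
    have hne : β i - β j ≠ 0 := sub_ne_zero.2 fun h => (Finset.mem_Ioi.1 hj).ne (hβ h)
    have h := rho_prod hne
    rw [← hρ] at h
    push_cast at h
    rw [neg_sub] at h
    linear_combination 16 * h
  rw [hpair]
  linear_combination (∏ j : Fin n, ∏ _k ∈ Finset.Ioi j, (-16 : ℂ)) *
        ((∏ i : Fin n, ∏ j ∈ Finset.Ioi i, ρ (β i - β j)) *
          (∏ i : Fin n, ∏ j ∈ Finset.Ioi i,
            (ρ (β i - β j + Real.pi * I) * ρ (β j - β i + Real.pi * I))) *
          ∏ i : Fin n, ∏ j ∈ Finset.Ioi i, ρ (β j - β i)) * hdiag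

/-! ### The factor of the integrand belonging to one position -/

/-- The site belonging to one of the `2n` positions. -/
def site {n : ℕ} (p : Fin (n + n)) : Fin n := Fin.append id Fin.rev p

/-- The exponent `2r - s + 1 - l` with `r = 1`, `s = n`. -/
def siteExponent {n : ℕ} (l : Fin n) : ℤ := (2 : ℤ) * 1 - (n : ℤ) + 1 - ((l : ℕ) + 1 : ℤ)

/-- The constant in front of the integral `I_{kp}`. -/
noncomputable def positionCoeff {n : ℕ} (p : Fin (n + n)) : ℂ :=
  Fin.append (fun l : Fin n => 2 * I ^ siteExponent l)
    (fun q : Fin n => 2 * I ^ (-siteExponent q.rev)) p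

/-- The power is distributed over the sites: `-1` for each of the `l` sites before `l`, `-i` for
each of the `n - 1 - l` sites after it. -/
theorem I_zpow_siteExponent {n : ℕ} (l : Fin n) :
    I ^ siteExponent l = I * (-I) ^ (n - 1 - (l : ℕ)) * (-1) ^ (l : ℕ) := by
  obtain ⟨m, hm⟩ : ∃ m : ℕ, n = m + l + 1 := ⟨n - 1 - l, by omega⟩
  have h1 : n - 1 - (l : ℕ) = m := by omega
  have h2 : siteExponent l = 1 - (m : ℤ) - ((2 * (l : ℕ) : ℕ) : ℤ) := by
    have hm' : (n : ℤ) = m + (l : ℕ) + 1 := by exact_mod_cast hm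
    rw [siteExponent]
    push_cast
    linear_combination -hm'
  rw [h1, h2, zpow_sub₀ I_ne_zero, zpow_sub₀ I_ne_zero, zpow_one, zpow_natCast, zpow_natCast,
    pow_mul, I_sq, div_eq_mul_inv, div_eq_mul_inv, ← inv_pow, ← inv_pow, inv_I]
  norm_num

theorem I_zpow_neg_siteExponent {n : ℕ} (l : Fin n) :
    I ^ (-siteExponent l) = -I * I ^ (n - 1 - (l : ℕ)) * (-1) ^ (l : ℕ) := by
  rw [zpow_neg, I_zpow_siteExponent, mul_inv, mul_inv, ← inv_pow, ← inv_pow, inv_neg, inv_I]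
  norm_num

theorem sinh_half_ne_zero {w : ℂ} (h : OffLattice (I * w)) : sinh (w / 2) ≠ 0 := by
  have := h.sin_ne_zero
  rw [show I * w / 2 = w / 2 * I by ring, Complex.sin_mul_I] at this
  exact (mul_ne_zero_iff.1 this).1

theorem cosh_half_ne_zero {w : ℂ} (h : OffLattice (Real.pi + I * w)) : cosh (w / 2) ≠ 0 := by
  have := h.sin_ne_zero
  rwa [show (Real.pi + I * w) / 2 = Real.pi / 2 - -(w / 2 * I) by ring, Complex.sin_pi_div_two_sub,
    Complex.cos_neg, Complex.cos_mul_I] at this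

theorem sinh_half_add_pi (c : ℂ) : sinh (c / 2 + Real.pi / 2 * I) = I * cosh (c / 2) := by
  rw [Complex.sinh_add, Complex.sinh_mul_I, Complex.cosh_mul_I, Complex.sin_pi_div_two,
    Complex.cos_pi_div_two]
  ring

theorem prod_phi {n : ℕ} (β : Fin n → ℝ) {w : ℂ} (h1 : ∀ j, OffLattice (I * (w - β j)))
    (h2 : ∀ j, OffLattice (Real.pi + I * (w - β j))) :
    ∏ j : Fin (n + n), phi (1 / 2) (2 * Real.pi) (w + Real.pi * I / 2 - corrParams β j) =
      ∏ j : Fin n, 1 / (2 * sinh ((w - β j) / 2) ^ 2 * cosh ((w - β j) / 2)) := by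
  rw [Fin.prod_univ_add]
  simp_rw [corrParams_castAdd, corrParams_natAdd]
  rw [prod_rev fun j => phi (1 / 2) (2 * Real.pi) (w + Real.pi * I / 2 - β j),
    ← Finset.prod_mul_distrib]
  refine Finset.prod_congr rfl fun j _ => ?_
  rw [← phi_mul_phi (h1 j) (h2 j), mul_comm]
  congr 2 <;> ring

theorem prod_Iio_sinh_castAdd {n : ℕ} (β : Fin n → ℝ) (w : ℂ) (l : Fin n) :
    ∏ j ∈ Finset.Iio (Fin.castAdd n l), sinh (((1 / 2 : ℝ) : ℂ) *
      (w + Real.pi * I / 2 - corrParams β j + Real.pi * I / 2)) =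
      ∏ j : Fin n, if j < l then sinh ((w - β j) / 2) else 1 := by
  have h1 : ∀ j : Fin n, Fin.castAdd n j < Fin.castAdd n l ↔ j < l := fun j => Iff.rfl
  have h2 : ∀ j : Fin n, ¬ Fin.natAdd n j < Fin.castAdd n l := fun j => by
    simp only [Fin.lt_def, Fin.val_castAdd, Fin.val_natAdd]
    omega
  rw [prod_Iio_eq_prod_ite, Fin.prod_univ_add]
  simp_rw [h1, h2, if_false, Finset.prod_const_one, mul_one, corrParams_castAdd]
  refine Finset.prod_congr rfl fun j _ => ?_
  congr 2
  push_cast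
  ring

theorem prod_Iio_sinh_natAdd {n : ℕ} (β : Fin n → ℝ) (w : ℂ) (q : Fin n) :
    ∏ j ∈ Finset.Iio (Fin.natAdd n q), sinh (((1 / 2 : ℝ) : ℂ) *
      (w + Real.pi * I / 2 - corrParams β j + Real.pi * I / 2)) =
      (∏ j : Fin n, sinh ((w - β j) / 2)) *
        ∏ j : Fin n, if q.rev < j then I * cosh ((w - β j) / 2) else 1 := by
  have h1 : ∀ j : Fin n, Fin.castAdd n j < Fin.natAdd n q := fun j => by
    simp only [Fin.lt_def, Fin.val_castAdd, Fin.val_natAdd]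
    omega
  have h2 : ∀ j : Fin n, Fin.natAdd n j < Fin.natAdd n q ↔ j < q := fun j => by
    rw [Fin.lt_def, Fin.lt_def, Fin.val_natAdd, Fin.val_natAdd, Nat.add_lt_add_iff_left]
  rw [prod_Iio_eq_prod_ite, Fin.prod_univ_add]
  simp_rw [h1, h2, if_true, corrParams_castAdd, corrParams_natAdd]
  rw [← prod_rev fun j => if q.rev < j then I * cosh ((w - β j) / 2) else 1]
  simp_rw [Fin.rev_lt_rev]
  congr 1
  · refine Finset.prod_congr rfl fun j _ => ?_
    congr 1
    push_cast
    ring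
  · refine Finset.prod_congr rfl fun j _ => ?_
    rw [← sinh_half_add_pi]
    congr 2
    push_cast
    ring

theorem prod_Ioi_sinh_castAdd {n : ℕ} (β : Fin n → ℝ) (w : ℂ) (l : Fin n) :
    ∏ j ∈ Finset.Ioi (Fin.castAdd n l), sinh (((1 / 2 : ℝ) : ℂ) *
      (corrParams β j - (w + Real.pi * I / 2) + Real.pi * I / 2)) =
      (∏ j : Fin n, if l < j then I * cosh ((w - β j) / 2) else 1) *
        ∏ j : Fin n, -sinh ((w - β j) / 2) := by
  have h1 : ∀ j : Fin n, Fin.castAdd n l < Fin.castAdd n j ↔ l < j := fun j => Iff.rfl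
  have h2 : ∀ j : Fin n, Fin.castAdd n l < Fin.natAdd n j := fun j => by
    simp only [Fin.lt_def, Fin.val_castAdd, Fin.val_natAdd]
    omega
  rw [prod_Ioi_eq_prod_ite, Fin.prod_univ_add]
  simp_rw [h1, h2, if_true, corrParams_castAdd, corrParams_natAdd]
  rw [← prod_rev fun j => -sinh ((w - β j) / 2)]
  congr 1
  · refine Finset.prod_congr rfl fun j _ => ?_
    rw [← Complex.cosh_neg, ← neg_div, ← sinh_half_add_pi]
    congr 2
    push_cast
    ring
  · refine Finset.prod_congr rfl fun j _ => ?_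
    rw [← Complex.sinh_neg]
    congr 1
    push_cast
    ring

theorem prod_Ioi_sinh_natAdd {n : ℕ} (β : Fin n → ℝ) (w : ℂ) (q : Fin n) :
    ∏ j ∈ Finset.Ioi (Fin.natAdd n q), sinh (((1 / 2 : ℝ) : ℂ) *
      (corrParams β j - (w + Real.pi * I / 2) + Real.pi * I / 2)) =
      ∏ j : Fin n, if j < q.rev then -sinh ((w - β j) / 2) else 1 := by
  have h1 : ∀ j : Fin n, ¬ Fin.natAdd n q < Fin.castAdd n j := fun j => by
    simp only [Fin.lt_def, Fin.val_castAdd, Fin.val_natAdd]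
    omega
  have h2 : ∀ j : Fin n, Fin.natAdd n q < Fin.natAdd n j ↔ q < j := fun j => by
    rw [Fin.lt_def, Fin.lt_def, Fin.val_natAdd, Fin.val_natAdd, Nat.add_lt_add_iff_left]
  rw [prod_Ioi_eq_prod_ite, Fin.prod_univ_add]
  simp_rw [h1, h2, if_false, Finset.prod_const_one, one_mul, corrParams_natAdd]
  rw [← prod_rev fun j => if j < q.rev then -sinh ((w - β j) / 2) else 1]
  simp_rw [Fin.rev_lt_rev]
  refine Finset.prod_congr rfl fun j _ => ?_
  rw [← Complex.sinh_neg]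
  congr 2
  push_cast
  ring

/-- Comparison site by site: the two sides differ by the constant `-1`, `-2` or `-i` according as
`j` is before, at or after `l`, and these constants multiply to the stated coefficient. -/
theorem prod_site_factor {n : ℕ} {s c : Fin n → ℂ} (hs : ∀ j, s j ≠ 0) (hc : ∀ j, c j ≠ 0)
    (l : Fin n) :
    (∏ j, 1 / (2 * s j ^ 2 * c j)) * ((∏ j, if j < l then s j else 1) *
      ((∏ j, if l < j then I * c j else 1) * ∏ j, -s j)) =
      I * (2 * I ^ siteExponent l) *
        ((∏ j ∈ Finset.Iic l, 1 / (2 * c j)) * ∏ j ∈ Finset.Ici l, 1 / (2 * s j)) := by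
  have hconst : I * (2 * I ^ siteExponent l) =
      ∏ j : Fin n, if j < l then (-1 : ℂ) else if j = l then -2 else -I := by
    rw [prod_lt_eq_gt, I_zpow_siteExponent]
    linear_combination 2 * (-I) ^ (n - 1 - (l : ℕ)) * (-1) ^ (l : ℕ) * I_mul_I
  rw [hconst, prod_Iic_eq_prod_ite, prod_Ici_eq_prod_ite]
  simp_rw [← Finset.prod_mul_distrib]
  refine Finset.prod_congr rfl fun j _ => ?_
  have := hs j
  have := hc j
  rcases lt_trichotomy j l with h | h | h
  · simp only [h, h.le, h.not_gt, h.not_ge, if_true, if_false]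
    field_simp
  · simp only [h, lt_irrefl, le_refl, if_true, if_false]
    have := hs l
    have := hc l
    field_simp
  · simp only [h, h.le, h.ne', h.not_gt, h.not_ge, if_true, if_false]
    field_simp

theorem prod_site_factor_conj {n : ℕ} {s c : Fin n → ℂ} (hs : ∀ j, s j ≠ 0) (hc : ∀ j, c j ≠ 0)
    (l : Fin n) :
    (∏ j, 1 / (2 * s j ^ 2 * c j)) * (((∏ j, s j) * ∏ j, if l < j then I * c j else 1) *
      ∏ j, if j < l then -s j else 1) =
      I * (2 * I ^ (-siteExponent l)) *
        ((∏ j ∈ Finset.Iic l, 1 / (2 * c j)) * ∏ j ∈ Finset.Ici l, 1 / (2 * s j)) := by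
  have hconst : I * (2 * I ^ (-siteExponent l)) =
      ∏ j : Fin n, if j < l then (-1 : ℂ) else if j = l then 2 else I := by
    rw [prod_lt_eq_gt, I_zpow_neg_siteExponent]
    linear_combination -2 * I ^ (n - 1 - (l : ℕ)) * (-1) ^ (l : ℕ) * I_mul_I
  rw [hconst, prod_Iic_eq_prod_ite, prod_Ici_eq_prod_ite]
  simp_rw [← Finset.prod_mul_distrib]
  refine Finset.prod_congr rfl fun j _ => ?_
  have := hs j
  have := hc j
  rcases lt_trichotomy j l with h | h | h
  · simp only [h, h.le, h.not_gt, h.not_ge, if_true, if_false]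
    field_simp
  · simp only [h, lt_irrefl, le_refl, if_true, if_false]
    have := hs l
    have := hc l
    field_simp
  · simp only [h, h.le, h.ne', h.not_gt, h.not_ge, if_true, if_false]
    field_simp

/-- The factor of the integrand for `G_n` that depends on `α_a` only, `p` being the position
`ā`. -/
noncomputable def positionFactor {n : ℕ} (b : Fin (n + n) → ℂ) (p : Fin (n + n)) (α : ℂ) : ℂ :=
  1 / (2 * Real.pi * I) * (∏ j : Fin (n + n), phi (1 / 2) (2 * Real.pi) (α - b j)) *
    ((∏ j ∈ Finset.Iio p, sinh (((1 / 2 : ℝ) : ℂ) * (α - b j + Real.pi * I / 2))) *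
      ∏ j ∈ Finset.Ioi p, sinh (((1 / 2 : ℝ) : ℂ) * (b j - α + Real.pi * I / 2)))

/-- The exponential is the Vandermonde entry that is multiplied into column `a`; with it the
single-variable factor becomes exactly the integrand of `I_{kp}`. -/
theorem positionFactor_mul_exp {n : ℕ} (β : Fin n → ℝ) {w : ℂ} (p : Fin (n + n)) (k : Fin n)
    (h1 : ∀ j, OffLattice (I * (w - β j))) (h2 : ∀ j, OffLattice (Real.pi + I * (w - β j))) :
    positionFactor (corrParams β) p (w + Real.pi * I / 2) *
      exp ((((k : ℕ) : ℂ) + 1 - ((n : ℂ) + 1) / 2) * w) =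
      positionCoeff p * integrandI β k (site p) w := by
  have hs : ∀ j, sinh ((w - β j) / 2) ≠ 0 := fun j => sinh_half_ne_zero (h1 j)
  have hc : ∀ j, cosh ((w - β j) / 2) ≠ 0 := fun j => cosh_half_ne_zero (h2 j)
  have hπ : (Real.pi : ℂ) ≠ 0 := ofReal_ne_zero.2 Real.pi_ne_zero
  have hI : (1 / (2 * Real.pi * I) : ℂ) * I = 1 / (2 * Real.pi) := by
    have := I_ne_zero
    field_simp
  refine Fin.addCases (fun l => ?_) (fun q => ?_) p
  · have key := prod_site_factor hs hc l
    rw [positionFactor, prod_phi β h1 h2, prod_Iio_sinh_castAdd, prod_Ioi_sinh_castAdd,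
      mul_assoc (1 / (2 * Real.pi * I) : ℂ), key]
    simp only [positionCoeff, site, Fin.append_left, id, integrandI]
    rw [← hI]
    ring
  · have key := prod_site_factor_conj hs hc q.rev
    rw [positionFactor, prod_phi β h1 h2, prod_Iio_sinh_natAdd, prod_Ioi_sinh_natAdd,
      mul_assoc (1 / (2 * Real.pi * I) : ℂ), key]
    simp only [positionCoeff, site, Fin.append_right, integrandI]
    rw [← hI]
    ring

/-! ### The integrand as a determinant -/

theorem two_mul_sinh_half_sub (u v : ℂ) :
    2 * sinh ((v - u) / 2) = (exp v - exp u) * (exp (-u / 2) * exp (-v / 2)) := by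
  rw [Complex.two_sinh, sub_mul, ← exp_add, ← exp_add, ← exp_add]
  congr 2 <;> ring

/-- A Vandermonde determinant in `e^{w_a}`, centred by scaling column `a` by `e^{-(n-1) w_a/2}`.
Each index lies in `n - 1` pairs, so the scalings distribute over the pairs and turn differences of
exponentials into `2 sinh`. -/
theorem det_exp_eq {n : ℕ} (w : Fin n → ℂ) :
    Matrix.det (Matrix.of fun k a : Fin n =>
      exp ((((k : ℕ) : ℂ) + 1 - ((n : ℂ) + 1) / 2) * w a)) =
      ∏ a, ∏ a' ∈ Finset.Ioi a, (2 * sinh ((w a' - w a) / 2)) := by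
  have hM : (Matrix.of fun k a : Fin n => exp ((((k : ℕ) : ℂ) + 1 - ((n : ℂ) + 1) / 2) * w a)) =
      Matrix.of fun k a : Fin n => exp (-w a / 2) ^ (n - 1) *
        (Matrix.vandermonde fun a => exp (w a)).transpose k a := by
    ext k a
    have hn : ((n - 1 : ℕ) : ℂ) = n - 1 := by
      rw [Nat.cast_sub (by have := k.2; omega), Nat.cast_one]
    simp only [Matrix.of_apply, Matrix.transpose_apply, Matrix.vandermonde_apply]
    rw [← exp_nat_mul, ← exp_nat_mul, ← exp_add, hn]
    congr 1
    ring
  rw [hM, Matrix.det_mul_row, Matrix.det_transpose, Matrix.det_vandermonde, ← prod_Ioi_mul,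
    mul_comm]
  simp_rw [two_mul_sinh_half_sub, Finset.prod_mul_distrib]

theorem sinh_half_sub_pi (d : ℂ) :
    sinh (((1 / 2 : ℝ) : ℂ) * (d - Real.pi * I)) = -I * cosh (d / 2) := by
  rw [← Complex.cosh_neg, neg_mul, ← neg_div, ← sinh_half_add_pi, ← Complex.sinh_neg]
  congr 1
  push_cast
  ring

/-- `ψ(d) = 2 sinh (d/2) cosh (d/2)`, and the denominator coming from `Q_n` is `-i cosh (d/2)`. -/
theorem psi_div_sinh {d : ℂ} (hd : OffLattice (Real.pi + I * d)) :
    psi (1 / 2) (2 * Real.pi) d / sinh (((1 / 2 : ℝ) : ℂ) * (d - Real.pi * I)) =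
      -I * (2 * sinh (-d / 2)) := by
  have hc := cosh_half_ne_zero hd
  have hI := I_ne_zero
  rw [psi_eq hd, sinh_half_sub_pi, neg_div 2 d, Complex.sinh_neg,
    div_eq_iff (mul_ne_zero (neg_ne_zero.2 hI) hc)]
  conv_lhs => rw [show d = 2 * (d / 2) by ring, Complex.sinh_two_mul]
  linear_combination (2 * sinh (d / 2) * cosh (d / 2)) * I_mul_I

theorem integrandG_eq_det {n : ℕ} (ε : Fin (n + n) → Bool) (hε : (plusSet ε).card = n)
    (β : Fin n → ℝ) (w : Fin n → ℂ)
    (h1 : ∀ a j, OffLattice (I * (w a - β j)))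
    (h2 : ∀ a j, OffLattice (Real.pi + I * (w a - β j)))
    (h3 : ∀ a a', OffLattice (Real.pi + I * (w a - w a'))) :
    integrandG (1 / 2) (2 * Real.pi) ε hε (corrParams β) (fun a => w a + Real.pi * I / 2) =
      (∏ a : Fin n, ∏ _a' ∈ Finset.Ioi a, -I) *
        Matrix.det (Matrix.of fun k a : Fin n =>
          positionCoeff (bar ε hε a) * integrandI β k (site (bar ε hε a)) (w a)) := by
  have hdet : Matrix.det (Matrix.of fun k a : Fin n =>
      positionCoeff (bar ε hε a) * integrandI β k (site (bar ε hε a)) (w a)) =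
      (∏ a, positionFactor (corrParams β) (bar ε hε a) (w a + Real.pi * I / 2)) *
        ∏ a, ∏ a' ∈ Finset.Ioi a, (2 * sinh ((w a' - w a) / 2)) := by
    simp_rw [← positionFactor_mul_exp β _ _ (h1 _) (h2 _)]
    rw [← det_exp_eq, ← Matrix.det_mul_row]
    rfl
  have hpsi : (∏ a : Fin n, ∏ _a' ∈ Finset.Ioi a, -I) *
      ∏ a, ∏ a' ∈ Finset.Ioi a, (2 * sinh ((w a' - w a) / 2)) =
      (∏ a : Fin n, ∏ a' ∈ Finset.Ioi a, psi (1 / 2) (2 * Real.pi) (w a - w a')) /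
        ∏ a : Fin n, ∏ a' ∈ Finset.Ioi a, sinh (((1 / 2 : ℝ) : ℂ) * (w a - w a' - Real.pi * I)) := by
    simp_rw [← Finset.prod_mul_distrib, ← Finset.prod_div_distrib]
    refine Finset.prod_congr rfl fun a _ => Finset.prod_congr rfl fun a' _ => ?_
    rw [psi_div_sinh (h3 a a'), neg_sub]
  rw [hdet, mul_left_comm, hpsi, integrandG, Q]
  simp_rw [add_sub_add_right_eq_sub, positionFactor, Finset.prod_mul_distrib]
  ring

theorem OffLattice.of_line {w b : ℂ} (h0 : (w - b).im ≠ 0) (h : |(w - b).im| < Real.pi) :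
    OffLattice (I * (w - b)) ∧ OffLattice (Real.pi + I * (w - b)) := by
  obtain ⟨h1, h2⟩ := abs_lt.1 h
  have e : (I * (w - b)).re = -(w - b).im := by simp
  have e' : ((Real.pi : ℂ) + I * (w - b)).re = Real.pi - (w - b).im := by
    rw [add_re, e, ofReal_re]
    ring
  refine ⟨?_, offLattice_of_re 0 ?_ ?_⟩
  · rcases lt_or_gt_of_ne h0 with h | h
    · refine offLattice_of_re 0 ?_ ?_
      · rw [e, Int.cast_zero]
        linarith
      · rw [e, Int.cast_zero]
        linarith
    · refine offLattice_of_re (-1) ?_ ?_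
      · rw [e]
        push_cast
        linarith
      · rw [e]
        push_cast
        linarith
  · rw [e', Int.cast_zero]
    linarith
  · rw [e', Int.cast_zero]
    linarith

theorem IsCorrContour.bounds {n : ℕ} {ε : Fin (n + n) → Bool} {hε : (plusSet ε).card = n}
    {h : Fin n → ℝ} (hh : IsCorrContour ε hε h) (a : Fin n) :
    0 < h a ∧ h a < Real.pi ∧ h a - Real.pi / 2 ≠ 0 := by
  have := Real.pi_pos
  rcases lt_or_ge (bar ε hε a : ℕ) n with h' | h'
  · obtain ⟨h1, h2⟩ := (hh a).1 h'
    exact ⟨by linarith, h2, (sub_pos.2 h1).ne'⟩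
  · obtain ⟨h1, h2⟩ := (hh a).2 h'
    exact ⟨h1, by linarith, (sub_neg.2 h2).ne⟩

theorem integrandG_onLines {n : ℕ} {ε : Fin (n + n) → Bool} {hε : (plusSet ε).card = n}
    {h : Fin n → ℝ} (hh : IsCorrContour ε hε h) (β : Fin n → ℝ) (t : Fin n → ℝ) :
    integrandG (1 / 2) (2 * Real.pi) ε hε (corrParams β) (onLines h t) =
      (∏ a : Fin n, ∏ _a' ∈ Finset.Ioi a, -I) *
        Matrix.det (Matrix.of fun k a : Fin n =>
          positionCoeff (bar ε hε a) * integrandI β k (site (bar ε hε a))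
            ((t a : ℂ) + ((h a - Real.pi / 2 : ℝ) : ℂ) * I)) := by
  have hline : onLines h t = fun a =>
      ((t a : ℂ) + ((h a - Real.pi / 2 : ℝ) : ℂ) * I) + Real.pi * I / 2 := by
    funext a
    rw [onLines]
    push_cast
    ring
  have him : ∀ a (j : Fin n), ((t a : ℂ) + ((h a - Real.pi / 2 : ℝ) : ℂ) * I - β j).im =
      h a - Real.pi / 2 := fun a j => by
    rw [sub_im, add_im, ofReal_im, ofReal_im, im_ofReal_mul, I_im]
    ring
  have him' : ∀ a a', ((t a : ℂ) + ((h a - Real.pi / 2 : ℝ) : ℂ) * I -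
      ((t a' : ℂ) + ((h a' - Real.pi / 2 : ℝ) : ℂ) * I)).im = h a - h a' := fun a a' => by
    rw [sub_im, add_im, add_im, ofReal_im, ofReal_im, im_ofReal_mul, im_ofReal_mul, I_im]
    ring
  have hoff : ∀ a (j : Fin n), _ := fun a j => OffLattice.of_line
    (w := (t a : ℂ) + ((h a - Real.pi / 2 : ℝ) : ℂ) * I) (b := β j)
    (by rw [him]; exact (hh.bounds a).2.2)
    (by rw [him, abs_lt]
        obtain ⟨b1, b2, -⟩ := hh.bounds a
        constructor <;> linarith)
  rw [hline]
  refine integrandG_eq_det ε hε β _ (fun a j => (hoff a j).1) (fun a j => (hoff a j).2)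
    fun a a' => ?_
  obtain ⟨b1, b2, -⟩ := hh.bounds a
  obtain ⟨b1', b2', -⟩ := hh.bounds a'
  -- Both heights lie in `(0, π)`, so the real part `π - (h a - h a')` stays strictly between `0`
  -- and `2π`.
  refine offLattice_of_re 0 ?_ ?_
  · rw [add_re, mul_re, I_re, I_im, him', ofReal_re, Int.cast_zero]
    linarith
  · rw [add_re, mul_re, I_re, I_im, him', ofReal_re, Int.cast_zero]
    linarith

/-! ### Integration of determinants -/

theorem integrable_det {n : ℕ} {f : Fin n → Fin n → ℝ → ℂ}
    (hf : ∀ k a, Integrable (f k a)) :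
    Integrable fun t : Fin n → ℝ => Matrix.det (Matrix.of fun k a : Fin n => f k a (t a)) := by
  simp_rw [Matrix.det_apply', Matrix.of_apply]
  exact integrable_finsetSum _ fun σ _ =>
    (Integrable.fintype_prod (f := fun a => f (σ a) a) fun a => hf _ a).const_mul _

/-- Column `a` depends on `t a` alone, so each term of the Leibniz expansion is a product in
separate variables and Fubini applies. -/
theorem integral_det {n : ℕ} {f : Fin n → Fin n → ℝ → ℂ} (hf : ∀ k a, Integrable (f k a)) :
    ∫ t : Fin n → ℝ, Matrix.det (Matrix.of fun k a : Fin n => f k a (t a)) =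
      Matrix.det (Matrix.of fun k a : Fin n => ∫ x, f k a x) := by
  simp_rw [Matrix.det_apply', Matrix.of_apply]
  rw [integral_finsetSum _ fun σ _ =>
    (Integrable.fintype_prod (f := fun a => f (σ a) a) fun a => hf _ a).const_mul _]
  refine Finset.sum_congr rfl fun σ _ => ?_
  rw [integral_const_mul, integral_fintype_prod_volume_eq_prod fun a => f (σ a) a]

/-- For the first `n` positions the shifted line is in the upper strip and can be moved to `η`. For
the last `n` it is the mirror image of the line at height `π/2 - h a`, and the coefficient `i^(-e)`
is the conjugate of `i^e`. -/
theorem entryIExt_eq {n : ℕ} {ε : Fin (n + n) → Bool} {hε : (plusSet ε).card = n}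
    {h : Fin n → ℝ} (hh : IsCorrContour ε hε h) (β : Fin n → ℝ) {η : ℝ} (h0 : 0 < η)
    (hπ : η < Real.pi) (k a : Fin n) :
    ∫ x : ℝ, positionCoeff (bar ε hε a) * integrandI β k (site (bar ε hε a))
        ((x : ℂ) + ((h a - Real.pi / 2 : ℝ) : ℂ) * I) = entryIExt β η k (bar ε hε a) := by
  have hp := Real.pi_pos
  obtain ⟨ha1, ha2⟩ := hh a
  rw [integral_const_mul]
  generalize bar ε hε a = p at ha1 ha2
  induction p using Fin.addCases with
  | left l =>
    obtain ⟨b1, b2⟩ := ha1 (by simp)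
    simp only [positionCoeff, site, entryIExt, Fin.append_left, id]
    rw [entryI, integral_integrandI_eq β k l (by linarith) (by linarith) h0 hπ]
    rfl
  | right q =>
    obtain ⟨b1, b2⟩ := ha2 (by simp)
    simp only [positionCoeff, site, entryIExt, Fin.append_right]
    rw [entryI, integral_integrandI_eq β k q.rev h0 hπ (η₂ := Real.pi / 2 - h a) (by linarith)
      (by linarith), map_mul, map_mul, conj_integral_integrandI, neg_sub, map_zpow₀, conj_I,
      zpow_neg, ← inv_zpow, inv_I, map_ofNat (starRingEnd ℂ) 2]
    rfl

theorem correlator_eq {n : ℕ} (ε' ε : Fin n → Bool)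
    (hε : (plusSet (corrSigns ε' ε)).card = n) {h : Fin n → ℝ}
    (hh : IsCorrContour (corrSigns ε' ε) hε h) {η : ℝ} (h0 : 0 < η) (hπ : η < Real.pi)
    {β : Fin n → ℝ} (hβ : Function.Injective β) :
    correlator (1 / 2) ε' ε hε h β = determinantFormula (corrSigns ε' ε) hε η β := by
  rw [correlator, G, prefactor_eq hβ, determinantFormula]
  simp_rw [integrandG_onLines hh β]
  rw [integral_const_mul, integral_det fun k a => (integrable_integrandI β k _
    (hh.bounds a).2.2 (by
      obtain ⟨b1, b2, -⟩ := hh.bounds a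
      rw [abs_lt]
      constructor <;> linarith)).const_mul _]
  simp_rw [entryIExt_eq hh β h0 hπ]
  rw [← mul_assoc]
  congr 1
  -- Pair by pair, `-2 cosh` from the prefactor meets `-i` from the integrand and gives `2i cosh`.
  simp_rw [← Finset.prod_mul_distrib]
  refine Finset.prod_congr rfl fun j _ => Finset.prod_congr rfl fun k _ => ?_
  ring

end XXZ

/-! ### The theorem -/

theorem mainTheorem6 (n : ℕ) (ε' ε : Fin n → Bool)
    (hε : (XXZ.plusSet (XXZ.corrSigns ε' ε)).card = n)
    (h : Fin n → ℝ) (hh : XXZ.IsCorrContour (XXZ.corrSigns ε' ε) hε h)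
    (η : ℝ) (hη₀ : 0 < η) (hηπ : η < Real.pi) (β : Fin n → ℝ) :
    -- the integrals involved converge absolutely
    MeasureTheory.Integrable (fun t : Fin n → ℝ =>
      XXZ.integrandG (1 / 2) (2 * Real.pi) (XXZ.corrSigns ε' ε) hε (XXZ.corrParams β)
        (XXZ.onLines h t)) ∧
    (∀ k l : Fin n, MeasureTheory.Integrable (fun t : ℝ =>
      XXZ.integrandI β k l ((t : ℂ) + (η : ℂ) * Complex.I))) ∧
    -- the formula for pairwise distinct parameters
    (Function.Injective β →
      XXZ.correlator (1 / 2) ε' ε hε h β =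
        XXZ.determinantFormula (XXZ.corrSigns ε' ε) hε η β) ∧
    -- the formula for arbitrary parameters, the correlator being extended continuously to
    -- coinciding parameters (where the factors `ρ(β_j - β_k)` have removable singularities)
    Filter.Tendsto (fun β' : Fin n → ℝ => XXZ.correlator (1 / 2) ε' ε hε h β')
      (nhdsWithin β {β' : Fin n → ℝ | Function.Injective β'})
      (nhds (XXZ.determinantFormula (XXZ.corrSigns ε' ε) hε η β)) := by
  refine ⟨?_, fun k l => ?_, fun hβ => XXZ.correlator_eq ε' ε hε hh hη₀ hηπ hβ, ?_⟩
  · simp_rw [XXZ.integrandG_onLines hh β]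
    refine (XXZ.integrable_det fun k a => (XXZ.integrable_integrandI β k _
      (hh.bounds a).2.2 ?_).const_mul _).const_mul _
    obtain ⟨b1, b2, -⟩ := hh.bounds a
    rw [abs_lt]
    constructor <;> linarith
  · exact XXZ.integrable_integrandI β k l hη₀.ne' (by rwa [abs_of_pos hη₀])
  -- The limit runs over injective parameters, where the correlator equals the determinant formula,
  -- and the latter is continuous everywhere.
  · have hc := (XXZ.continuous_determinantFormula (XXZ.corrSigns ε' ε) hε hη₀ hηπ).tendsto β
    refine (hc.mono_left nhdsWithin_le_nhds).congr' ?_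
    filter_upwards [self_mem_nhdsWithin] with β' hβ'
    exact (XXZ.correlator_eq ε' ε hε hh hη₀ hηπ hβ').symm
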